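/- Let $m>0$ and let $D_m=i\alpha\partial_x+\beta m$, with $\alpha=\begin{pmatrix}-1&0\\0&1\end{pmatrix}$ and $\beta=\begin{pmatrix}0&1\\1&0\end{pmatrix}$, be the free one-dimensional Dirac operator on $L^2(\mathbb R;\mathbb C^2)$ with domain $H^1(\mathbb R;\mathbb C^2)$. Write $\langle x\rangle=(1+|x|^2)^{1/2}$. Let $V:\mathbb R\to\mathbb C^{2\times 2}$ be a matrix potential, not necessarily self-adjoint, with continuous entries such that for some $\epsilon>0$ and $C<\infty$ one has $|V_{ij}(x)|\le C\langle x\rangle^{-1-\epsilon}$ for all $x\in\mathbb R$ and all $i,j$, and let $H=D_m+V$, with domain $H^1(\mathbb R;\mathbb C^2)$. Then for every $\sigma>\frac12$ there are $\lambda_1\in(m,\infty)$ and $\delta>0$, depending on $V$, $m$ and $\sigma$, such that every $\lambda+i\gamma$ with $\lambda,\gamma\in\mathbb R$, $|\lambda|>\lambda_1$ and $0<|\gamma|<\delta|\lambda|$ lies in the resolvent set of $H$, and $$\sup_{\substack{|\lambda|>\lambda_1\\ 0<|\gamma|<\delta|\lambda|}}\big\|\langle x\rangle^{-\sigma}\,(H-(\lambda+i\gamma))^{-1}\,\langle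 x\rangle^{-\sigma}\big\|_{L^2\to L^2}<\infty .$$ Moreover, there is a compact set $K\subset\mathbb C$ such that every point of the spectrum of $H$ outside $K$ is real. -/

import Mathlib

noncomputable section

namespace Dirac1D

open MeasureTheory
open scoped ENNReal SchwartzMap LineDeriv

/-- `ℂ²` with its Hermitian norm. -/
abbrev Spinor : Type := EuclideanSpace ℂ (Fin 2)

/-- The Hilbert space `L²(ℝ; ℂ²)`. -/
abbrev SpinorL2 : Type := Lp Spinor 2 (volume : Measure ℝ)

/-- The Japanese bracket `⟨x⟩ = (1 + |x|²)^{1/2}`. -/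
def bracket (x : ℝ) : ℝ := Real.sqrt (1 + |x| ^ 2)

/-- `g ∈ L²` is the distributional derivative of `u ∈ L²`. -/
def HasDistribDeriv (u g : SpinorL2) : Prop :=
  ∂_{(1 : ℝ)} (u : 𝓢'(ℝ, Spinor)) = (g : 𝓢'(ℝ, Spinor))

lemma HasDistribDeriv.unique {u g h : SpinorL2} (hg : HasDistribDeriv u g)
    (hh : HasDistribDeriv u h) : g = h :=
  LinearMap.ker_eq_bot.1 (Lp.ker_toTemperedDistributionCLM_eq_bot
    (F := Spinor) (μ := (volume : Measure ℝ)) (p := 2)) (hg.symm.trans hh)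

lemma HasDistribDeriv.add {u v g h : SpinorL2} (hu : HasDistribDeriv u g)
    (hv : HasDistribDeriv v h) : HasDistribDeriv (u + v) (g + h) := by
  unfold HasDistribDeriv at *
  simp only [← Lp.toTemperedDistributionCLM_apply] at *
  rw [map_add, map_add, LineDeriv.lineDerivOp_add, hu, hv]

lemma HasDistribDeriv.smul {u g : SpinorL2} (c : ℂ) (hu : HasDistribDeriv u g) :
    HasDistribDeriv (c • u) (c • g) := by
  unfold HasDistribDeriv at *
  simp only [← Lp.toTemperedDistributionCLM_apply] at *
  rw [map_smul, map_smul, LineDeriv.lineDerivOp_smul, hu]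

lemma HasDistribDeriv.zero : HasDistribDeriv 0 0 := by
  simpa using (show HasDistribDeriv ((0 : ℂ) • 0) ((0 : ℂ) • 0) from by
    unfold HasDistribDeriv
    simp only [← Lp.toTemperedDistributionCLM_apply]
    rw [map_smul, LineDeriv.lineDerivOp_smul, zero_smul, zero_smul])

/-- The derivative `∂ₓ` on `L²(ℝ; ℂ²)`, with domain the Sobolev space `H¹(ℝ; ℂ²)`. -/
def derivOp : SpinorL2 →ₗ.[ℂ] SpinorL2 where
  domain :=
    { carrier := {u | ∃ g, HasDistribDeriv u g}
      add_mem' := fun ⟨g, hg⟩ ⟨h, hh⟩ => ⟨g + h, hg.add hh⟩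
      zero_mem' := ⟨0, HasDistribDeriv.zero⟩
      smul_mem' := fun c _ ⟨g, hg⟩ => ⟨c • g, hg.smul c⟩ }
  toFun :=
    { toFun := fun u => u.2.choose
      map_add' := fun u v =>
        (u + v).2.choose_spec.unique (u.2.choose_spec.add v.2.choose_spec)
      map_smul' := fun c u => (c • u).2.choose_spec.unique (u.2.choose_spec.smul c) }

/-- The action of a constant matrix on `L²(ℝ; ℂ²)`. -/
def constMatrix (A : Matrix (Fin 2) (Fin 2) ℂ) : SpinorL2 →L[ℂ] SpinorL2 :=
  (Matrix.toEuclideanCLM (n := Fin 2) (𝕜 := ℂ) A).compLpL 2 (volume : Measure ℝ)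

/-- The matrix `α`. -/
def alpha : Matrix (Fin 2) (Fin 2) ℂ := !![-1, 0; 0, 1]

/-- The matrix `β`. -/
def beta : Matrix (Fin 2) (Fin 2) ℂ := !![0, 1; 1, 0]

/-- The free Dirac operator `D_m = i α ∂ₓ + m β` with domain `H¹(ℝ; ℂ²)`. -/
def freeDirac (m : ℝ) : SpinorL2 →ₗ.[ℂ] SpinorL2 :=
  ((m : ℂ) • constMatrix beta).toLinearMap +ᵥ
    (Complex.I • constMatrix alpha).toLinearMap.compPMap derivOp

/-- The pointwise product `x ↦ V(x) u(x)` of a matrix function and a spinor field. -/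
def mulFun (V : ℝ → Matrix (Fin 2) (Fin 2) ℂ) (u : SpinorL2) : ℝ → Spinor :=
  fun x => Matrix.toEuclideanCLM (n := Fin 2) (𝕜 := ℂ) (V x) (u x)

lemma mulFun_add (V : ℝ → Matrix (Fin 2) (Fin 2) ℂ) (u v : SpinorL2) :
    mulFun V (u + v) =ᵐ[volume] mulFun V u + mulFun V v := by
  filter_upwards [Lp.coeFn_add u v] with x hx
  simp only [mulFun, Pi.add_apply, hx, map_add]

lemma mulFun_smul (V : ℝ → Matrix (Fin 2) (Fin 2) ℂ) (c : ℂ) (u : SpinorL2) :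
    mulFun V (c • u) =ᵐ[volume] c • mulFun V u := by
  filter_upwards [Lp.coeFn_smul c u] with x hx
  simp only [mulFun, Pi.smul_apply, hx, map_smul]

lemma mulFun_zero (V : ℝ → Matrix (Fin 2) (Fin 2) ℂ) :
    mulFun V 0 =ᵐ[volume] (0 : ℝ → Spinor) := by
  filter_upwards [Lp.coeFn_zero Spinor 2 (volume : Measure ℝ)] with x hx
  simp only [mulFun, hx, Pi.zero_apply, map_zero]

/-- Multiplication by the matrix function `V`, on its maximal domain `{u ∈ L² : V u ∈ L²}`. -/
def mulOp (V : ℝ → Matrix (Fin 2) (Fin 2) ℂ) : SpinorL2 →ₗ.[ℂ] SpinorL2 where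
  domain :=
    { carrier := {u | MemLp (mulFun V u) 2 volume}
      add_mem' := fun {u v} hu hv => (memLp_congr_ae (mulFun_add V u v)).2 (hu.add hv)
      zero_mem' := (memLp_congr_ae (mulFun_zero V)).2 MemLp.zero
      smul_mem' := fun c u hu => (memLp_congr_ae (mulFun_smul V c u)).2 (hu.const_smul c) }
  toFun :=
    { toFun := fun u => MemLp.toLp (mulFun V u) u.2
      map_add' := fun u v => by
        rw [← MemLp.toLp_add]
        exact (MemLp.toLp_eq_toLp_iff _ _).2 (mulFun_add V u v)
      map_smul' := fun c u => by
        rw [RingHom.id_apply, ← MemLp.toLp_const_smul]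
        exact (MemLp.toLp_eq_toLp_iff _ _).2 (mulFun_smul V c u) }

/-- The perturbed Dirac operator `H = D_m + V`, with domain the intersection of the two domains;
for bounded measurable `V` this is `H¹(ℝ; ℂ²)`. -/
def dirac (m : ℝ) (V : ℝ → Matrix (Fin 2) (Fin 2) ℂ) : SpinorL2 →ₗ.[ℂ] SpinorL2 :=
  freeDirac m + mulOp V

/-- The bounded operator `R` is the resolvent `(A - z)⁻¹` of the unbounded operator `A`. -/
structure IsResolvent {E : Type*} [NormedAddCommGroup E] [NormedSpace ℂ E]
    (A : E →ₗ.[ℂ] E) (z : ℂ) (R : E →L[ℂ] E) : Prop where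
  mem_domain : ∀ f, R f ∈ A.domain
  right_inv : ∀ f, A ⟨R f, mem_domain f⟩ - z • R f = f
  left_inv : ∀ u : A.domain, R (A u - z • (u : E)) = u

/-- The resolvent set of an unbounded operator. -/
def resolventSet {E : Type*} [NormedAddCommGroup E] [NormedSpace ℂ E]
    (A : E →ₗ.[ℂ] E) : Set ℂ :=
  {z | ∃ R : E →L[ℂ] E, IsResolvent A z R}

/-- The spectrum of an unbounded operator. -/
def unboundedSpectrum {E : Type*} [NormedAddCommGroup E] [NormedSpace ℂ E]
    (A : E →ₗ.[ℂ] E) : Set ℂ :=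
  (resolventSet A)ᶜ

lemma one_le_bracket (x : ℝ) : 1 ≤ bracket x :=
  Real.one_le_sqrt.2 (by nlinarith [sq_nonneg |x|])

lemma memLp_weight (σ : ℝ) (hσ : 0 ≤ σ) :
    MemLp (fun x : ℝ => ((bracket x ^ (-σ) : ℝ) : ℂ)) ∞ volume := by
  refine memLp_top_of_bound ?_ 1 (Filter.Eventually.of_forall fun x => ?_)
  · refine Measurable.aestronglyMeasurable ?_
    unfold bracket
    fun_prop
  · have h := one_le_bracket x
    rw [Complex.norm_real, Real.norm_of_nonneg (by positivity)]
    exact Real.rpow_le_one_of_one_le_of_nonpos h (by linarith)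

/-- Multiplication by `⟨x⟩^{-σ}`, `σ ≥ 0`, as a bounded operator on `L²(ℝ; ℂ²)`. -/
def weight (σ : ℝ) (hσ : 0 ≤ σ) : SpinorL2 →L[ℂ] SpinorL2 :=
  (ContinuousLinearMap.lsmul ℂ ℂ (E := Spinor)).holderL (volume : Measure ℝ) ∞ 2 2
    (memLp_weight σ hσ).toLp

end Dirac1D

end

noncomputable section

namespace Dirac1D

open MeasureTheory Filter Topology
open scoped ENNReal SchwartzMap LineDeriv

/-! ### First-order scalar equations -/

/-! The equation $(H-z)u=f$ is a $2\times2$ linear ODE system, and everything rests on a sup bound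
for its bounded solutions that is uniform in non-real $z$ with $|z|$ large. Diagonalising the free
symbol (`exists_diagonalization`) gives variables $p,q$ with $p'=ikp+\dots$, $q'=-ikq+\dots$, where
$k$ lies on the same side of the real axis as $z$, $|\operatorname{Im}k|\ge|\operatorname{Im}z|$ and
$|k|\ge|z|/2$. For $\operatorname{Im}k>0$ a bounded solution of the damped scalar equation
$y'=(ik+A)y+g$ is given by Duhamel's formula from $-\infty$, so $\|y\|_\infty\le e^{\|A\|_1}\|g\|_1$
uniformly in $k$; an $L^2$ source costs a factor $1/\sqrt{\operatorname{Im}k}$. The equation for $q$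
is the reflection of this one.

The coupling terms have $L^1$ coefficients that need not be small, so they cannot be absorbed
directly. But $p$ and $q$ oscillate at opposite frequencies: `norm_le_of_system` approximates the
coefficient $B$ of $q$ in the $p$-equation by a Schwartz $\beta$ and passes to $p+\beta q/(2ik)$,
which removes $\beta q$ up to errors $O(1/|k|)$. What remains is $B-\beta$, small in $L^1$. This
quantitative Riemann–Lebesgue argument uses only that $|k|$ is large and $\operatorname{Im}k\neq0$,
not the angle of $z$.

Two consequences follow. Taking the source in $L^2$, the sup bound controls $Vu$ in $L^2$; with the
energy identity for the symmetric free operator this bounds $\|u\|$ by $\|(H-z)u\|$. The same bound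
for $V^*$ and $\bar z$ makes the range dense, so $z$ is in the resolvent set
(`exists_forall_isResolvent_dirac`). Taking the source in $L^1$, the sup bound has a constant
independent of $z$; since $\langle x\rangle^{-\sigma}\in L^2$ for $\sigma>1/2$, one weight sends
$L^2$ into $L^1$ and the other sends $L^\infty$ into $L^2$ (`exists_norm_weighted_resolvent_le`).

The ODE estimates are applied to Schwartz spinors only, which is enough because these are dense in
$H^1$ for the graph norm (`HasDistribDeriv.exists_schwartz_tendsto`). -/

lemma integral_mul_le_sqrt {α : Type*} [MeasurableSpace α] {μ : Measure α} {f g : α → ℝ}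
    (hf0 : ∀ x, 0 ≤ f x) (hg0 : ∀ x, 0 ≤ g x) (hf : MemLp f 2 μ) (hg : MemLp g 2 μ) :
    ∫ x, f x * g x ∂μ ≤ √(∫ x, f x ^ 2 ∂μ) * √(∫ x, g x ^ 2 ∂μ) := by
  have h := integral_mul_le_Lp_mul_Lq_of_nonneg (μ := μ) (f := f) (g := g)
    Real.HolderConjugate.two_two (Filter.Eventually.of_forall hf0)
    (Filter.Eventually.of_forall hg0) (by simpa using hf) (by simpa using hg)
  simpa [Real.sqrt_eq_rpow] using h

lemma integral_exp_sq_le {κ : ℝ} (hκ : 0 < κ) (a x : ℝ) :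
    ∫ s in a..x, Real.exp (-κ * (x - s)) ^ 2 ≤ 1 / κ := by
  have h : ∀ s ∈ Set.uIcc a x, HasDerivAt (fun s => Real.exp (-(2 * κ) * (x - s)) / (2 * κ))
      (Real.exp (-κ * (x - s)) ^ 2) s := by
    intro s _
    have h1 : HasDerivAt (fun s => -(2 * κ) * (x - s)) (-(2 * κ) * (0 - 1)) s :=
      ((hasDerivAt_const s x).sub (hasDerivAt_id s)).const_mul _
    refine ((h1.exp).div_const (2 * κ)).congr_deriv ?_
    rw [← Real.exp_nat_mul, show ((2 : ℕ) : ℝ) * (-κ * (x - s)) = -(2 * κ) * (x - s) by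
      push_cast; ring]
    field_simp
    ring
  rw [intervalIntegral.integral_eq_sub_of_hasDerivAt h
    (Continuous.intervalIntegrable (by fun_prop) _ _)]
  have h0 : 0 ≤ Real.exp (-(2 * κ) * (x - a)) / (2 * κ) := by positivity
  have h1 : Real.exp (-(2 * κ) * (x - x)) / (2 * κ) = 1 / (2 * κ) := by simp
  have h2 : 1 / (2 * κ) ≤ 1 / κ := one_div_le_one_div_of_le hκ (by linarith)
  linarith

/-- The size of a source bounded by `φ + ψ`, with `φ ∈ L¹` and `ψ ∈ L²`, for the equation with
damping rate `κ`. -/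
def sourceSize (κ : ℝ) (φ ψ : ℝ → ℝ) : ℝ := (∫ x, φ x) + √(∫ x, ψ x ^ 2) / √κ

/-- Admissible majorants of a source: nonnegative functions `φ ∈ L¹` and `ψ ∈ L²`. -/
structure IsMajorant (φ ψ : ℝ → ℝ) : Prop where
  nonneg_left : ∀ x, 0 ≤ φ x
  nonneg_right : ∀ x, 0 ≤ ψ x
  integrable : Integrable φ
  memLp : MemLp ψ 2

lemma sourceSize_nonneg {κ : ℝ} {φ ψ : ℝ → ℝ} (h : IsMajorant φ ψ) : 0 ≤ sourceSize κ φ ψ :=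
  add_nonneg (integral_nonneg h.nonneg_left) (by positivity)

/-- Allows the rate $|\operatorname{Im}k|$ produced by the diagonalisation to be replaced by the
smaller $|\operatorname{Im}z|$. -/
lemma sourceSize_anti {κ κ' : ℝ} (hκ : 0 < κ) (h : κ ≤ κ') (φ ψ : ℝ → ℝ) :
    sourceSize κ' φ ψ ≤ sourceSize κ φ ψ := by
  unfold sourceSize
  gcongr

lemma sourceSize_const_mul {κ c : ℝ} (hc : 0 ≤ c) (φ ψ : ℝ → ℝ) :
    sourceSize κ (fun x => c * φ x) (fun x => c * ψ x) = c * sourceSize κ φ ψ := by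
  unfold sourceSize
  simp only [mul_pow, integral_const_mul]
  rw [Real.sqrt_mul (by positivity), Real.sqrt_sq hc]
  ring

lemma IsMajorant.const_mul {c : ℝ} (hc : 0 ≤ c) {φ ψ : ℝ → ℝ} (h : IsMajorant φ ψ) :
    IsMajorant (fun x => c * φ x) (fun x => c * ψ x) :=
  ⟨fun x => mul_nonneg hc (h.1 x), fun x => mul_nonneg hc (h.2 x), h.3.const_mul c,
    h.4.const_mul c⟩

lemma IsMajorant.add_left {φ φ' ψ : ℝ → ℝ} (h : IsMajorant φ ψ) (h0 : ∀ x, 0 ≤ φ' x)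
    (hi : Integrable φ') : IsMajorant (fun x => φ x + φ' x) ψ :=
  ⟨fun x => add_nonneg (h.1 x) (h0 x), h.2, h.3.add hi, h.4⟩

lemma sourceSize_add_left {κ : ℝ} {φ φ' ψ : ℝ → ℝ} (h : IsMajorant φ ψ)
    (hi : Integrable φ') :
    sourceSize κ (fun x => φ x + φ' x) ψ = sourceSize κ φ ψ + ∫ x, φ' x := by
  unfold sourceSize
  rw [integral_add h.3 hi]
  ring

lemma IsMajorant.reflect {φ ψ : ℝ → ℝ} (h : IsMajorant φ ψ) :
    IsMajorant (fun x => φ (-x)) (fun x => ψ (-x)) :=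
  ⟨fun _ => h.1 _, fun _ => h.2 _, h.3.comp_neg,
    h.4.comp_measurePreserving (Measure.measurePreserving_neg _)⟩

lemma sourceSize_reflect (κ : ℝ) (φ ψ : ℝ → ℝ) :
    sourceSize κ (fun x => φ (-x)) (fun x => ψ (-x)) = sourceSize κ φ ψ := by
  unfold sourceSize
  rw [integral_neg_eq_self φ, integral_neg_eq_self (fun x => ψ x ^ 2)]

/-- On $s\le x$ the damped kernel is at most $1$, which handles $\varphi\in L^1$; its $L^2$ norm is
at most $\kappa^{-1/2}$, which handles $\psi\in L^2$ by Cauchy–Schwarz. -/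
lemma integral_exp_mul_majorant_le {κ : ℝ} (hκ : 0 < κ) {φ ψ : ℝ → ℝ} (h : IsMajorant φ ψ)
    {a x : ℝ} (hax : a ≤ x) :
    IntervalIntegrable (fun s => Real.exp (-κ * (x - s)) * (φ s + ψ s)) volume a x ∧
    ∫ s in a..x, Real.exp (-κ * (x - s)) * (φ s + ψ s) ≤ sourceSize κ φ ψ := by
  have hc : Continuous fun s => Real.exp (-κ * (x - s)) := by fun_prop
  have hφ : IntervalIntegrable φ volume a x := h.3.intervalIntegrable
  have hψ2 : MemLp ψ 2 (volume.restrict (Set.Ioc a x)) := h.4.restrict _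
  have hψ : IntervalIntegrable ψ volume a x := by
    rw [intervalIntegrable_iff_integrableOn_Ioc_of_le hax]
    exact hψ2.integrable (by norm_num)
  have h1 := hφ.continuousOn_mul hc.continuousOn
  have h2 := hψ.continuousOn_mul hc.continuousOn
  have he2 : MemLp (fun s => Real.exp (-κ * (x - s))) 2 (volume.restrict (Set.Ioc a x)) := by
    refine MemLp.of_bound hc.aestronglyMeasurable 1
      ((ae_restrict_iff' measurableSet_Ioc).2 (Filter.Eventually.of_forall fun s hs => ?_))
    rw [Real.norm_of_nonneg (Real.exp_pos _).le]
    exact Real.exp_le_one_iff.2 (by nlinarith [hs.2])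
  refine ⟨by simpa only [mul_add] using h1.add h2, ?_⟩
  simp only [mul_add]
  rw [intervalIntegral.integral_add h1 h2]
  unfold sourceSize
  gcongr
  · calc ∫ s in a..x, Real.exp (-κ * (x - s)) * φ s ≤ ∫ s in a..x, φ s := by
          refine intervalIntegral.integral_mono_on hax h1 hφ fun s hs => ?_
          refine mul_le_of_le_one_left (h.1 s) (Real.exp_le_one_iff.2 ?_)
          nlinarith [hs.2]
      _ ≤ ∫ s, φ s := by
          rw [intervalIntegral.integral_of_le hax]
          exact setIntegral_le_integral h.3 (Filter.Eventually.of_forall h.1)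
  · rw [intervalIntegral.integral_of_le hax]
    refine (integral_mul_le_sqrt (fun s => (Real.exp_pos _).le) h.2 he2 hψ2).trans ?_
    rw [mul_comm, div_eq_mul_inv, ← Real.sqrt_inv]
    gcongr
    · exact Filter.Eventually.of_forall fun s => sq_nonneg _
    · exact h.4.integrable_sq
    · exact Measure.restrict_le_self
    · rw [← intervalIntegral.integral_of_le hax, ← one_div]
      exact integral_exp_sq_le hκ a x

lemma norm_integral_le_integral_majorant {A : ℝ → ℂ} {ω : ℝ → ℝ} (hω : Integrable ω)
    (hA : ∀ x, ‖A x‖ ≤ ω x) (a b : ℝ) : ‖∫ s in a..b, A s‖ ≤ ∫ s, ω s := by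
  have h0 : ∀ x, 0 ≤ ω x := fun x => (norm_nonneg _).trans (hA x)
  refine intervalIntegral.norm_integral_le_integral_norm_uIoc.trans ?_
  calc ∫ s in Set.uIoc a b, ‖A s‖ ≤ ∫ s in Set.uIoc a b, ω s := by
        refine integral_mono_of_nonneg (Filter.Eventually.of_forall fun _ => norm_nonneg _)
          hω.integrableOn (Filter.Eventually.of_forall hA)
    _ ≤ ∫ s, ω s := setIntegral_le_integral hω (Filter.Eventually.of_forall h0)

/-- Sup bound for bounded solutions of a damped first-order equation. -/
lemma norm_le_of_hasDerivAt_forward {k : ℂ} (hk : 0 < k.im) {A g y : ℝ → ℂ} {ω φ ψ : ℝ → ℝ}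
    (hAc : Continuous A) (hω : Integrable ω) (hA : ∀ x, ‖A x‖ ≤ ω x) (hgc : Continuous g)
    (hm : IsMajorant φ ψ) (hg : ∀ x, ‖g x‖ ≤ φ x + ψ x) {b : ℝ} (hb : ∀ x, ‖y x‖ ≤ b)
    (hy : ∀ x, HasDerivAt y ((Complex.I * k + A x) * y x + g x) x) (x : ℝ) :
    ‖y x‖ ≤ Real.exp (∫ x, ω x) * sourceSize k.im φ ψ := by
  set M := ∫ x, ω x
  set N := sourceSize k.im φ ψ
  -- Exponent of the integrating factor, normalised to vanish at $s=x$: `exp (e s)` propagates the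
  -- homogeneous equation from $s$ to $x$.
  let e : ℝ → ℂ := fun s => Complex.I * k * (x - s) + ∫ t in s..x, A t
  have he : ∀ s, HasDerivAt e (-(Complex.I * k + A s)) s := by
    intro s
    have h1 : HasDerivAt (fun s : ℝ => ∫ t in s..x, A t) (-A s) s :=
      intervalIntegral.integral_hasDerivAt_left (hAc.intervalIntegrable _ _)
        (hAc.stronglyMeasurableAtFilter _ _) hAc.continuousAt
    have h2 : HasDerivAt (fun s : ℝ => Complex.I * k * ((x : ℂ) - (s : ℂ)))
        (Complex.I * k * (0 - 1)) s :=
      (((hasDerivAt_const s (x : ℂ)).sub (HasDerivAt.ofReal_comp (hasDerivAt_id s))).const_mul _)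
    refine (h2.add h1).congr_deriv ?_
    ring
  have hen : ∀ s, ‖Complex.exp (e s)‖ ≤ Real.exp M * Real.exp (-k.im * (x - s)) := by
    intro s
    rw [Complex.norm_exp, ← Real.exp_add]
    refine Real.exp_le_exp.2 ?_
    have h1 : (e s).re = -k.im * (x - s) + (∫ t in s..x, A t).re := by
      simp only [e, Complex.add_re, Complex.mul_re, Complex.mul_im, Complex.I_re, Complex.I_im,
        Complex.sub_re, Complex.sub_im, Complex.ofReal_re, Complex.ofReal_im]
      ring
    have h2 := (Complex.re_le_norm _).trans (norm_integral_le_integral_majorant hω hA s x)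
    rw [h1]
    linarith
  have hec : Continuous fun s => Complex.exp (e s) :=
    (continuous_iff_continuousAt.2 fun s => (he s).continuousAt).cexp
  -- Duhamel's formula started at $a$. As $a\to-\infty$ the damping kills the initial value because
  -- $y$ is bounded, so $b$ disappears from the final bound.
  have key : ∀ a ≤ x, ‖y x‖ ≤ Real.exp M * (Real.exp (-k.im * (x - a)) * b + N) := by
    intro a ha
    have hd : ∀ s ∈ Set.uIcc a x, HasDerivAt (fun s => Complex.exp (e s) * y s)
        (Complex.exp (e s) * g s) s := by
      intro s _
      refine ((he s).cexp.mul (hy s)).congr_deriv ?_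
      ring
    have hi := intervalIntegral.integral_eq_sub_of_hasDerivAt hd
      ((hec.mul hgc).intervalIntegrable _ _)
    have hex : Complex.exp (e x) = 1 := by simp [e]
    rw [hex, one_mul] at hi
    have hyx : y x = (∫ s in a..x, Complex.exp (e s) * g s) + Complex.exp (e a) * y a := by
      rw [hi]; ring
    obtain ⟨hI, hIle⟩ := integral_exp_mul_majorant_le hk hm ha
    have h1 : ‖∫ s in a..x, Complex.exp (e s) * g s‖ ≤ Real.exp M * N := by
      calc ‖∫ s in a..x, Complex.exp (e s) * g s‖
          ≤ ∫ s in a..x, Real.exp M * (Real.exp (-k.im * (x - s)) * (φ s + ψ s)) := by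
            refine intervalIntegral.norm_integral_le_of_norm_le ha
              (Filter.Eventually.of_forall fun s _ => ?_) (hI.const_mul _)
            rw [norm_mul, ← mul_assoc]
            exact mul_le_mul (hen s) (hg s) (norm_nonneg _) (by positivity)
        _ ≤ Real.exp M * N := by
            rw [intervalIntegral.integral_const_mul]
            gcongr
    have h2 : ‖Complex.exp (e a) * y a‖ ≤ Real.exp M * (Real.exp (-k.im * (x - a)) * b) := by
      rw [norm_mul, ← mul_assoc]
      exact mul_le_mul (hen a) (hb a) (norm_nonneg _) (by positivity)
    have h3 := norm_add_le (∫ s in a..x, Complex.exp (e s) * g s) (Complex.exp (e a) * y a)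
    rw [← hyx] at h3
    linarith [h1, h2]
  have hlim : Filter.Tendsto (fun a => Real.exp M * (Real.exp (-k.im * (x - a)) * b + N))
      Filter.atBot (nhds (Real.exp M * (0 * b + N))) := by
    refine (((Real.tendsto_exp_atBot.comp ?_).mul_const b).add_const N).const_mul _
    have : Filter.Tendsto (fun a : ℝ => k.im * a + -k.im * x) Filter.atBot Filter.atBot :=
      Filter.tendsto_atBot_add_const_right _ _ (Filter.tendsto_id.const_mul_atBot hk)
    refine this.congr fun a => by ring
  rw [zero_mul, zero_add] at hlim
  refine ge_of_tendsto hlim ?_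
  filter_upwards [Filter.eventually_le_atBot x] with a ha using key a ha

/-- The reflection $x\mapsto-x$ turns this equation into the forward one, with $A$ and $g$ changing
sign. -/
lemma norm_le_of_hasDerivAt_backward {k : ℂ} (hk : 0 < k.im) {A g y : ℝ → ℂ} {ω φ ψ : ℝ → ℝ}
    (hAc : Continuous A) (hω : Integrable ω) (hA : ∀ x, ‖A x‖ ≤ ω x) (hgc : Continuous g)
    (hm : IsMajorant φ ψ) (hg : ∀ x, ‖g x‖ ≤ φ x + ψ x) {b : ℝ} (hb : ∀ x, ‖y x‖ ≤ b)
    (hy : ∀ x, HasDerivAt y ((-Complex.I * k + A x) * y x + g x) x) (x : ℝ) :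
    ‖y x‖ ≤ Real.exp (∫ x, ω x) * sourceSize k.im φ ψ := by
  have h := norm_le_of_hasDerivAt_forward hk (A := fun x => -A (-x)) (g := fun x => -g (-x))
    (y := fun x => y (-x)) (ω := fun x => ω (-x)) (φ := fun x => φ (-x)) (ψ := fun x => ψ (-x))
    (by fun_prop) hω.comp_neg (fun x => by simpa using hA (-x)) (by fun_prop) hm.reflect
    (fun x => by simpa using hg (-x)) (fun x => hb (-x)) (fun x => ?_) (-x)
  · simpa [sourceSize_reflect, integral_neg_eq_self ω] using h
  · have h1 := (hy (-x)).scomp x (hasDerivAt_neg x)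
    refine h1.congr_deriv ?_
    simp only [neg_smul, one_smul]
    ring

/-! ### Two-component systems with large frequency -/

/-- Sup bound for bounded solutions of
`p' = (ik + A) p + B q + g`, `q' = (-ik + D) q + C p + h`, under the smallness condition that
results from replacing `p` by `p + β q / (2ik)`, where `β` is a regular approximation of `B`. -/
lemma norm_le_of_system {k : ℂ} (hk : 0 < k.im) {A B C D β β' g h p q : ℝ → ℂ}
    {ω φ ψ : ℝ → ℝ} {b₁ η : ℝ}
    (hAc : Continuous A) (hBc : Continuous B) (hCc : Continuous C) (hDc : Continuous D)
    (hβc' : Continuous β') (hgc : Continuous g) (hhc : Continuous h)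
    (hω : Integrable ω) (hA : ∀ x, ‖A x‖ ≤ ω x) (hC : ∀ x, ‖C x‖ ≤ ω x) (hD : ∀ x, ‖D x‖ ≤ ω x)
    (hβ : ∀ x, HasDerivAt β (β' x) x) (hβb : ∀ x, ‖β x‖ ≤ b₁)
    (hBβ : Integrable fun x => ‖B x - β x‖) (hβ' : Integrable fun x => ‖β' x‖)
    (hη₁ : b₁ / (2 * ‖k‖) ≤ η) (hη1 : η ≤ 1)
    (hη₂ : (∫ x, ‖B x - β x‖) + (3 * b₁ * (∫ x, ω x) + ∫ x, ‖β' x‖) / (2 * ‖k‖) ≤ η)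
    (hη₃ : η * (Real.exp (∫ x, ω x) + 2 * Real.exp (∫ x, ω x) ^ 2 * ∫ x, ω x) ≤ 1 / 2)
    (hm : IsMajorant φ ψ) (hg : ∀ x, ‖g x‖ ≤ φ x + ψ x) (hh : ∀ x, ‖h x‖ ≤ φ x + ψ x)
    {b : ℝ} (hpb : ∀ x, ‖p x‖ ≤ b) (hqb : ∀ x, ‖q x‖ ≤ b)
    (hp : ∀ x, HasDerivAt p ((Complex.I * k + A x) * p x + B x * q x + g x) x)
    (hq : ∀ x, HasDerivAt q ((-Complex.I * k + D x) * q x + C x * p x + h x) x) (x : ℝ) :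
    ‖p x‖ ≤ 8 * Real.exp (∫ x, ω x) ^ 2 * sourceSize k.im φ ψ ∧
    ‖q x‖ ≤ (1 + 8 * Real.exp (∫ x, ω x) ^ 2 * ∫ x, ω x) * Real.exp (∫ x, ω x) *
      sourceSize k.im φ ψ := by
  set M := ∫ x, ω x with hMdef
  set N := sourceSize k.im φ ψ with hNdef
  set E := Real.exp M with hEdef
  have hk0 : k ≠ 0 := by rintro rfl; simp at hk
  have hkn : 0 < ‖k‖ := norm_pos_iff.2 hk0
  have hω0 : ∀ x, 0 ≤ ω x := fun x => (norm_nonneg _).trans (hA x)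
  have hM0 : 0 ≤ M := integral_nonneg hω0
  have hN0 : 0 ≤ N := sourceSize_nonneg hm
  have hE1 : 1 ≤ E := Real.one_le_exp hM0
  have hb₁0 : 0 ≤ b₁ := (norm_nonneg _).trans (hβb 0)
  have hη0 : 0 ≤ η := le_trans (by positivity) hη₁
  have hpc : Continuous p := continuous_iff_continuousAt.2 fun s => (hp s).continuousAt
  have hqc : Continuous q := continuous_iff_continuousAt.2 fun s => (hq s).continuousAt
  have hβc : Continuous β := continuous_iff_continuousAt.2 fun s => (hβ s).continuousAt
  -- Both suprema are finite by the qualitative bound `b`; this is what permits absorbing them at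
  -- the end.
  set Sp := ⨆ x, ‖p x‖
  set Sq := ⨆ x, ‖q x‖
  have hSp : ∀ x, ‖p x‖ ≤ Sp := fun x => le_ciSup (f := fun x => ‖p x‖)
    ⟨b, by rintro _ ⟨x, rfl⟩; exact hpb x⟩ x
  have hSq : ∀ x, ‖q x‖ ≤ Sq := fun x => le_ciSup (f := fun x => ‖q x‖)
    ⟨b, by rintro _ ⟨x, rfl⟩; exact hqb x⟩ x
  have hSp0 : 0 ≤ Sp := (norm_nonneg _).trans (hSp 0)
  have hSq0 : 0 ≤ Sq := (norm_nonneg _).trans (hSq 0)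
  -- Here $Cp$ is treated as an $L^1$ source with majorant `Sp * ω`; no smallness is needed for this
  -- half.
  have hq_le : ∀ x, ‖q x‖ ≤ E * (N + M * Sp) := by
    intro x
    have hmm := hm.add_left (φ' := fun x => Sp * ω x) (fun x => mul_nonneg hSp0 (hω0 x))
      (hω.const_mul _)
    have := norm_le_of_hasDerivAt_backward hk (A := D) (g := fun x => C x * p x + h x) (y := q)
      hDc hω hD (by fun_prop) hmm (fun x => ?_) hqb (fun x => ?_) x
    · rw [sourceSize_add_left hm (hω.const_mul _), integral_const_mul] at this
      rwa [mul_comm M Sp]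
    · refine (norm_add_le _ _).trans ?_
      rw [norm_mul]
      have := mul_le_mul (hC x) (hSp x) (norm_nonneg _) (hω0 x)
      linarith [hh x]
    · exact (hq x).congr_deriv (by ring)
  -- Chosen so that $2ik\Psi=-\beta$: in the equation for $p-\Psi q$ the coefficient $B+2ik\Psi$ of
  -- $q$ becomes $B-\beta$.
  let Ψ : ℝ → ℂ := fun x => -β x / (2 * Complex.I * k)
  have hΨn : ∀ x, ‖Ψ x‖ ≤ b₁ / (2 * ‖k‖) := by
    intro x
    simp only [Ψ, norm_div, norm_neg, norm_mul, Complex.norm_I, mul_one, Complex.norm_ofNat]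
    gcongr
    exact hβb x
  have hΨη : ∀ x, ‖Ψ x‖ ≤ η := fun x => (hΨn x).trans hη₁
  have hΨd : ∀ x, HasDerivAt Ψ (-β' x / (2 * Complex.I * k)) x := fun x => (hβ x).neg.div_const _
  have hΨc : Continuous Ψ := continuous_iff_continuousAt.2 fun s => (hΨd s).continuousAt
  -- Collects the $L^1$ coefficients multiplying $p$ or $q$ in the new source `G`: $B-\beta$,
  -- $\Psi'$, and $\Psi$ times $A$, $D$ and $C$, whence the factor $3$.
  let err : ℝ → ℝ := fun x =>
    ‖B x - β x‖ + (3 * b₁ * ω x + ‖β' x‖) / (2 * ‖k‖)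
  have herr0 : ∀ x, 0 ≤ err x := fun x => by
    have := hω0 x
    positivity
  have hi₁ : Integrable fun x => 3 * b₁ * ω x + ‖β' x‖ := (hω.const_mul _).add hβ'
  have herri : Integrable err := hBβ.add (hi₁.div_const _)
  have herrI : ∫ x, err x ≤ η := by
    refine le_trans (le_of_eq ?_) hη₂
    simp only [err]
    rw [integral_add hBβ (hi₁.div_const _), integral_div,
      integral_add (hω.const_mul _) hβ', integral_const_mul]
  let G : ℝ → ℂ := fun x => g x + (B x - β x) * q x + (A x - D x) * Ψ x * q x
    - (-β' x / (2 * Complex.I * k)) * q x - Ψ x * C x * p x - Ψ x * h x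
  have hGc : Continuous G := by fun_prop
  have hG : ∀ x, ‖G x‖ ≤ (2 * φ x + (Sp + Sq) * err x) + 2 * ψ x := by
    intro x
    have e1 : ‖(B x - β x) * q x‖ ≤ ‖B x - β x‖ * (Sp + Sq) := by
      rw [norm_mul]; gcongr; linarith [hSq x]
    have e2 : ‖(A x - D x) * Ψ x * q x‖ ≤ (2 * ω x * (b₁ / (2 * ‖k‖))) * Sq := by
      rw [norm_mul, norm_mul]
      have hω0 := hω0 x
      gcongr
      · exact (norm_sub_le _ _).trans (by linarith [hA x, hD x])
      · exact hΨn x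
      · exact hSq x
    have e3 : ‖(-β' x / (2 * Complex.I * k)) * q x‖ ≤ ‖β' x‖ / (2 * ‖k‖) * (Sp + Sq) := by
      simp only [norm_div, norm_neg, norm_mul, Complex.norm_I, mul_one, Complex.norm_ofNat]
      gcongr
      linarith [hSq x]
    have e4 : ‖Ψ x * C x * p x‖ ≤ (b₁ / (2 * ‖k‖)) * ω x * Sp := by
      rw [norm_mul, norm_mul]
      have hω0 := hω0 x
      gcongr
      · exact hΨn x
      · exact hC x
      · exact hSp x
    have e5 : ‖Ψ x * h x‖ ≤ φ x + ψ x := by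
      rw [norm_mul]
      have := mul_le_mul ((hΨη x).trans hη1) (hh x) (norm_nonneg _) zero_le_one
      linarith
    have e6 : 0 ≤ ω x * (b₁ / (2 * ‖k‖)) * (Sp + Sq) + (b₁ / (2 * ‖k‖)) * ω x * Sp := by
      have := hω0 x
      positivity
    have e7 : (Sp + Sq) * err x = ‖B x - β x‖ * (Sp + Sq) + ‖β' x‖ / (2 * ‖k‖) * (Sp + Sq) +
        3 * (ω x * (b₁ / (2 * ‖k‖)) * (Sp + Sq)) := by
      simp only [err]; ring
    have e8 : 0 ≤ ω x * (b₁ / (2 * ‖k‖)) * Sp := by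
      have := hω0 x
      positivity
    have e9 : 0 ≤ ω x * (b₁ / (2 * ‖k‖)) * Sq := by
      have := hω0 x
      positivity
    have n1 : ‖G x‖ ≤ ‖g x‖ + ‖(B x - β x) * q x‖ + ‖(A x - D x) * Ψ x * q x‖
        + ‖(-β' x / (2 * Complex.I * k)) * q x‖ + ‖Ψ x * C x * p x‖ + ‖Ψ x * h x‖ := by
      refine (norm_sub_le _ _).trans (add_le_add_left ?_ _)
      refine (norm_sub_le _ _).trans (add_le_add_left ?_ _)
      refine (norm_sub_le _ _).trans (add_le_add_left ?_ _)
      exact norm_add₃_le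
    rw [e7]
    nlinarith [hg x]
  have hr_le : ∀ x, ‖p x - Ψ x * q x‖ ≤ E * (2 * N + (Sp + Sq) * η) := by
    intro x
    have hm2 := hm.const_mul (c := 2) zero_le_two
    have hei := herri.const_mul (Sp + Sq)
    have hmm := hm2.add_left (φ' := fun x => (Sp + Sq) * err x)
      (fun x => mul_nonneg (by positivity) (herr0 x)) hei
    have := norm_le_of_hasDerivAt_forward hk (A := A) (g := G) (y := fun x => p x - Ψ x * q x)
      hAc hω hA hGc hmm hG (b := b + η * b) (fun x => ?_) (fun x => ?_) x
    · rw [sourceSize_add_left hm2 hei, sourceSize_const_mul zero_le_two, integral_const_mul]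
        at this
      refine this.trans ?_
      gcongr
    · refine (norm_sub_le _ _).trans (add_le_add (hpb x) ?_)
      rw [norm_mul]
      exact mul_le_mul (hΨη x) (hqb x) (norm_nonneg _) hη0
    · refine ((hp x).sub ((hΨd x).mul (hq x))).congr_deriv ?_
      have : 2 * Complex.I * k * Ψ x = -β x := by
        simp only [Ψ]
        field_simp
      simp only [G]
      generalize Ψ x = c at this
      linear_combination (q x) * this
  have hSq_le : Sq ≤ E * (N + M * Sp) := ciSup_le hq_le
  have hp_le : ∀ x, ‖p x‖ ≤ E * (2 * N + (Sp + Sq) * η) + η * Sq := by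
    intro x
    have h1 : ‖p x‖ ≤ ‖p x - Ψ x * q x‖ + ‖Ψ x * q x‖ := by
      simpa using norm_add_le (p x - Ψ x * q x) (Ψ x * q x)
    have h2 : ‖Ψ x * q x‖ ≤ η * Sq := by
      rw [norm_mul]
      exact mul_le_mul (hΨη x) (hSq x) (norm_nonneg _) hη0
    linarith [hr_le x]
  have hSp_le : Sp ≤ E * (2 * N + (Sp + Sq) * η) + η * Sq := ciSup_le hp_le
  -- Inserting the bound for `Sq` gives a coefficient $\eta(E+2E^2M)\le1/2$ in front of `Sp`, which
  -- is absorbed; the rest is at most $2EN+2\eta E^2N\le4E^2N$.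
  have hSpN : Sp ≤ 8 * E ^ 2 * N := by
    have a1 : η * Sq ≤ η * (E * Sq) := by
      gcongr
      exact le_mul_of_one_le_left hSq0 hE1
    have a2 : (2 * η * E) * Sq ≤ (2 * η * E) * (E * (N + M * Sp)) := by gcongr
    have a3 : η * (E + 2 * E ^ 2 * M) * Sp ≤ 1 / 2 * Sp := by gcongr
    have a4 : E * N ≤ E ^ 2 * N := by
      have : E ≤ E ^ 2 := by nlinarith
      gcongr
    have a5 : η * (E ^ 2 * N) ≤ 1 * (E ^ 2 * N) := by gcongr
    nlinarith
  refine ⟨(hSp x).trans hSpN, (hq_le x).trans ?_⟩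
  have : E * (N + M * Sp) ≤ E * (N + M * (8 * E ^ 2 * N)) := by gcongr
  linarith

/-! ### Uniformity over the coefficients -/

/-- Schwartz functions are dense in `L¹`. -/
lemma exists_schwartz_integral_norm_sub_le {f : ℝ → ℂ} (hf : Integrable f) {τ : ℝ} (hτ : 0 < τ) :
    ∃ W : 𝓢(ℝ, ℂ), ∫ x, ‖f x - W x‖ ≤ τ := by
  have hd := SchwartzMap.denseRange_toLpCLM (E := ℝ) (F := ℂ) (p := 1) ENNReal.one_ne_top (μ := volume)
  obtain ⟨W, hW⟩ := hd.exists_dist_lt hf.toL1 hτ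
  refine ⟨W, le_of_eq_of_le ?_ hW.le⟩
  rw [dist_eq_norm, L1.norm_eq_integral_norm]
  refine integral_congr_ae ?_
  filter_upwards [Lp.coeFn_sub hf.toL1 (SchwartzMap.toLpCLM ℝ ℂ 1 volume W), hf.coeFn_toL1,
    W.coeFn_toLp 1 volume] with x h1 h2 h3
  simp only [SchwartzMap.toLpCLM_apply] at h1 ⊢
  rw [h1, Pi.sub_apply, h2, h3]

/-- The linear form `∑ cᵢⱼ Xᵢⱼ` on matrices. -/
def lincomb (c X : Matrix (Fin 2) (Fin 2) ℂ) : ℂ := ∑ i, ∑ j, c i j * X i j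

lemma norm_lincomb_le {c X : Matrix (Fin 2) (Fin 2) ℂ} (hc : ∀ i j, ‖c i j‖ ≤ 2) :
    ‖lincomb c X‖ ≤ 2 * ∑ i, ∑ j, ‖X i j‖ := by
  unfold lincomb
  rw [Finset.mul_sum]
  refine norm_sum_le_of_le _ fun i _ => ?_
  rw [Finset.mul_sum]
  refine norm_sum_le_of_le _ fun j _ => ?_
  rw [norm_mul]
  exact mul_le_mul_of_nonneg_right (hc i j) (norm_nonneg _)

lemma norm_lincomb_le_of_le {c X : Matrix (Fin 2) (Fin 2) ℂ} (hc : ∀ i j, ‖c i j‖ ≤ 2) {b : ℝ}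
    (hX : ∀ i j, ‖X i j‖ ≤ b) : ‖lincomb c X‖ ≤ 8 * b := by
  refine (norm_lincomb_le hc).trans ?_
  simp only [Fin.sum_univ_two]
  linarith [hX 0 0, hX 0 1, hX 1 0, hX 1 1]

lemma continuous_lincomb (c : Matrix (Fin 2) (Fin 2) ℂ) {X : ℝ → Matrix (Fin 2) (Fin 2) ℂ}
    (hX : ∀ i j, Continuous fun x => X x i j) : Continuous fun x => lincomb c (X x) := by
  unfold lincomb
  fun_prop

/-- Uniform sup bound, for large `|k|`, for all systems whose coefficients are linear forms with
bounded coefficients in the entries of a fixed integrable potential. -/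
lemma exists_norm_le_of_system {V : ℝ → Matrix (Fin 2) (Fin 2) ℂ} {ω : ℝ → ℝ}
    (hVc : ∀ i j, Continuous fun x => V x i j) (hω : Integrable ω)
    (hV : ∀ x i j, ‖V x i j‖ ≤ ω x) :
    ∃ R K : ℝ, 0 < K ∧ ∀ (k : ℂ) (a b c d : Matrix (Fin 2) (Fin 2) ℂ) (g h p q : ℝ → ℂ)
      (φ ψ : ℝ → ℝ) (M : ℝ), 0 < k.im → R ≤ ‖k‖ →
      (∀ i j, ‖a i j‖ ≤ 2) → (∀ i j, ‖b i j‖ ≤ 2) → (∀ i j, ‖c i j‖ ≤ 2) →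
      (∀ i j, ‖d i j‖ ≤ 2) → Continuous g → Continuous h → IsMajorant φ ψ →
      (∀ x, ‖g x‖ ≤ φ x + ψ x) → (∀ x, ‖h x‖ ≤ φ x + ψ x) →
      (∀ x, ‖p x‖ ≤ M) → (∀ x, ‖q x‖ ≤ M) →
      (∀ x, HasDerivAt p
        ((Complex.I * k + lincomb a (V x)) * p x + lincomb b (V x) * q x + g x) x) →
      (∀ x, HasDerivAt q
        ((-Complex.I * k + lincomb d (V x)) * q x + lincomb c (V x) * p x + h x) x) →
      ∀ x, ‖p x‖ ≤ K * sourceSize k.im φ ψ ∧ ‖q x‖ ≤ K * sourceSize k.im φ ψ := by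
  have hω0 : ∀ x, 0 ≤ ω x := fun x => (norm_nonneg _).trans (hV x 0 0)
  set Ω := ∫ x, 8 * ω x with hΩ
  have hΩ0 : 0 ≤ Ω := integral_nonneg fun x => by have := hω0 x; positivity
  set E := Real.exp Ω with hE
  have hE0 : 0 < E := Real.exp_pos _
  have hVi : ∀ i j, Integrable fun x => V x i j := fun i j =>
    hω.mono' (hVc i j).aestronglyMeasurable (Filter.Eventually.of_forall fun x => hV x i j)
  set S := E + 2 * E ^ 2 * Ω with hS
  have hS0 : 0 < S := by positivity
  obtain ⟨η, hη0, hη1, hηS⟩ : ∃ η : ℝ, 0 < η ∧ η ≤ 1 ∧ η * S ≤ 1 / 2 := by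
    refine ⟨min 1 (1 / (2 * S)), by positivity, min_le_left _ _, ?_⟩
    calc min 1 (1 / (2 * S)) * S ≤ 1 / (2 * S) * S := by gcongr; exact min_le_right _ _
      _ = 1 / 2 := by field_simp
  -- Four entries with coefficients of size at most $2$ give a total $L^1$ error
  -- $2\cdot4\cdot\eta/16=\eta/2$, leaving the other half of $\eta$ for the $O(1/|k|)$ terms.
  choose W hW using fun i j =>
    exists_schwartz_integral_norm_sub_le (hVi i j) (τ := η / 16) (by positivity)
  have hWs : ∀ i j, Integrable fun x => V x i j - W i j x := fun i j =>
    (hVi i j).sub (W i j).integrable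
  have hWb : ∃ b₀ : ℝ, 0 ≤ b₀ ∧ ∀ i j x, ‖W i j x‖ ≤ b₀ := by
    refine ⟨∑ i, ∑ j, ‖(W i j).toBoundedContinuousFunction‖, by positivity, fun i j x => ?_⟩
    refine ((W i j).toBoundedContinuousFunction.norm_coe_le_norm x).trans ?_
    refine le_trans ?_ (Finset.single_le_sum (f := fun i =>
      ∑ j, ‖(W i j).toBoundedContinuousFunction‖) (fun i _ => by positivity) (Finset.mem_univ i))
    exact Finset.single_le_sum (f := fun j => ‖(W i j).toBoundedContinuousFunction‖)
      (fun i _ => by positivity) (Finset.mem_univ j)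
  obtain ⟨b₀, hb₀0, hb₀⟩ := hWb
  let W' : Fin 2 → Fin 2 → 𝓢(ℝ, ℂ) := fun i j => SchwartzMap.derivCLM ℝ ℂ (W i j)
  have hWd : ∀ i j x, HasDerivAt (W i j) (W' i j x) x := fun i j x => by
    simpa [W'] using (W i j).differentiableAt.hasDerivAt
  set T := 3 * (8 * b₀) * Ω + 2 * ∑ i, ∑ j, ∫ x, ‖W' i j x‖ with hT
  have hT0 : 0 ≤ T := by
    have : 0 ≤ ∑ i, ∑ j, ∫ x, ‖W' i j x‖ := by positivity
    positivity
  -- The threshold forces $T+8b_0\le\eta|k|$, so that both $b_1/(2|k|)$ and the $O(1/|k|)$ errors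
  -- are at most $\eta/2$; the summand $1$ keeps $|k|$ positive.
  refine ⟨1 + (T + 8 * b₀) / η, 8 * E ^ 2 + (1 + 8 * E ^ 2 * Ω) * E, by positivity, ?_⟩
  intro k a b c d g h p q φ ψ M hk hkR ha hb hc hd hg hh hm hgm hhm hpM hqM hp hq x
  have hkn : 0 < ‖k‖ := lt_of_lt_of_le (by positivity) hkR
  have hkη : T + 8 * b₀ ≤ η * ‖k‖ := by
    have h1 : (T + 8 * b₀) / η ≤ ‖k‖ := by linarith
    rw [div_le_iff₀ hη0] at h1
    linarith
  have hβ : ∀ x, HasDerivAt (fun x => lincomb b fun i j => W i j x)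
      (lincomb b fun i j => W' i j x) x := fun x => by
    unfold lincomb
    exact HasDerivAt.fun_sum fun i _ => HasDerivAt.fun_sum fun j _ => (hWd i j x).const_mul _
  have hsub : ∀ x, lincomb b (V x) - (lincomb b fun i j => W i j x) =
      lincomb b fun i j => V x i j - W i j x := fun x => by
    simp only [lincomb, Fin.sum_univ_two]
    ring
  have hdom : ∀ x, ‖lincomb b (V x) - (lincomb b fun i j => W i j x)‖ ≤
      2 * ∑ i, ∑ j, ‖V x i j - W i j x‖ := fun x => by
    rw [hsub]
    exact norm_lincomb_le hb
  have hVWi : Integrable fun x => 2 * ∑ i, ∑ j, ‖V x i j - W i j x‖ :=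
    (integrable_finsetSum _ fun i _ => integrable_finsetSum _ fun j _ => (hWs i j).norm).const_mul _
  have hW'i : Integrable fun x => 2 * ∑ i, ∑ j, ‖W' i j x‖ :=
    (integrable_finsetSum _ fun i _ => integrable_finsetSum _ fun j _ =>
      (W' i j).integrable.norm).const_mul _
  have hβc' : Continuous fun x => lincomb b fun i j => W' i j x :=
    continuous_lincomb b fun i j => (W' i j).continuous
  have hβc : Continuous fun x => lincomb b fun i j => W i j x :=
    continuous_lincomb b fun i j => (W i j).continuous
  have hBβ : Integrable fun x => ‖lincomb b (V x) - (lincomb b fun i j => W i j x)‖ :=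
    hVWi.mono' ((continuous_lincomb b hVc).sub hβc).norm.aestronglyMeasurable
      (Filter.Eventually.of_forall fun x => by simpa using hdom x)
  have hβ' : Integrable fun x => ‖lincomb b fun i j => W' i j x‖ :=
    hW'i.mono' hβc'.norm.aestronglyMeasurable
      (Filter.Eventually.of_forall fun x => by simpa using norm_lincomb_le hb)
  have hI1 : ∫ x, ‖lincomb b (V x) - (lincomb b fun i j => W i j x)‖ ≤ η / 2 := by
    refine (integral_mono hBβ hVWi hdom).trans ?_
    rw [integral_const_mul, integral_finsetSum _ fun i _ =>
      integrable_finsetSum _ fun j _ => (hWs i j).norm]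
    simp_rw [integral_finsetSum _ fun j _ => (hWs _ j).norm]
    simp only [Fin.sum_univ_two]
    linarith [hW 0 0, hW 0 1, hW 1 0, hW 1 1]
  have hI2 : ∫ x, ‖lincomb b fun i j => W' i j x‖ ≤ 2 * ∑ i, ∑ j, ∫ x, ‖W' i j x‖ := by
    refine (integral_mono hβ' hW'i fun x => norm_lincomb_le hb).trans (le_of_eq ?_)
    rw [integral_const_mul, integral_finsetSum _ fun i _ =>
      integrable_finsetSum _ fun j _ => (W' i j).integrable.norm]
    simp_rw [integral_finsetSum _ fun j _ => (W' _ j).integrable.norm]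
  have hN0 : 0 ≤ sourceSize k.im φ ψ := sourceSize_nonneg hm
  have key := norm_le_of_system hk (ω := fun x => 8 * ω x) (b₁ := 8 * b₀) (η := η)
    (continuous_lincomb a hVc) (continuous_lincomb b hVc) (continuous_lincomb c hVc)
    (continuous_lincomb d hVc) hβc' hg hh (hω.const_mul _)
    (fun x => norm_lincomb_le_of_le ha (hV x)) (fun x => norm_lincomb_le_of_le hc (hV x))
    (fun x => norm_lincomb_le_of_le hd (hV x)) hβ
    (fun x => norm_lincomb_le_of_le hb fun i j => hb₀ i j x) hBβ hβ' ?_ hη1 ?_ hηS hm hgm hhm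
    hpM hqM hp hq x
  · rw [← hΩ, ← hE] at key
    constructor
    · refine key.1.trans ?_
      gcongr
      exact le_add_of_nonneg_right (by positivity)
    · refine key.2.trans ?_
      gcongr
      exact le_add_of_nonneg_left (by positivity)
  · rw [div_le_iff₀ (by positivity)]
    nlinarith
  · have : (3 * (8 * b₀) * Ω + ∫ x, ‖lincomb b fun i j => W' i j x‖) / (2 * ‖k‖) ≤ η / 2 := by
      rw [div_le_iff₀ (by positivity)]
      nlinarith
    linarith

/-! ### Diagonalisation of the Dirac system -/

/-- Data diagonalising the free symbol: with `p = u₁ - a u₂` and `q = u₂ - a u₁` the free system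
decouples into `p' = i k p`, `q' = -i k q`. -/
lemma exists_diagonalization {m : ℝ} (hm : 0 < m) {z : ℂ} (hmz : 2 * m ≤ ‖z‖) :
    ∃ a k : ℂ, k = z - a * m ∧ k * a = m - a * z ∧ ‖a‖ ≤ 1 / 2 ∧ ‖z‖ / 2 ≤ ‖k‖ ∧
      (0 < z.im → z.im ≤ k.im) ∧ (z.im < 0 → k.im ≤ z.im) := by
  have hm0 : (m : ℂ) ≠ 0 := by exact_mod_cast hm.ne'
  obtain ⟨s, hs⟩ := IsAlgClosed.exists_pow_nat_eq (z ^ 2 - (m : ℂ) ^ 2) (n := 2) two_pos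
  -- The two roots of $ma^2-2za+m=0$ have product $1$, so one of them lies in the closed unit disc.
  obtain ⟨a, ha, ha1⟩ : ∃ a : ℂ, m * a ^ 2 + m = 2 * z * a ∧ ‖a‖ ≤ 1 := by
    have hprod : ((z - s) / m) * ((z + s) / m) = 1 := by
      field_simp
      linear_combination -hs
    rcases le_or_gt ‖(z - s) / m‖ 1 with h | h
    · refine ⟨_, ?_, h⟩
      field_simp
      linear_combination hs
    · refine ⟨(z + s) / m, ?_, ?_⟩
      · field_simp
        linear_combination hs
      · have := congrArg norm hprod
        rw [norm_mul, norm_one] at this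
        by_contra! h'
        nlinarith
  have hz0 : 0 < ‖z‖ := by linarith
  have haz : ‖a‖ * ‖z‖ ≤ m := by
    have h1 := congrArg norm ha
    have h2 : ‖(m : ℂ) * a ^ 2 + m‖ ≤ 2 * m := by
      refine (norm_add_le _ _).trans ?_
      rw [norm_mul, norm_pow, Complex.norm_real, Real.norm_of_nonneg hm.le]
      have : ‖a‖ ^ 2 ≤ 1 := pow_le_one₀ (norm_nonneg _) ha1
      nlinarith
    rw [h1, norm_mul, norm_mul, Complex.norm_ofNat] at h2
    linarith
  have ha2 : ‖a‖ ≤ 1 / 2 := by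
    by_contra! h
    nlinarith
  -- Since $|a|<1$, this identity shows that $m\operatorname{Im}a$ and $\operatorname{Im}z$ have
  -- opposite signs (or the former vanishes). Hence
  -- $\operatorname{Im}k=\operatorname{Im}z-m\operatorname{Im}a$ has the sign of
  -- $\operatorname{Im}z$ and is at least as large in absolute value.
  have him : 2 * z.im * Complex.normSq a = m * a.im * (Complex.normSq a - 1) := by
    have h1 : 2 * z * Complex.normSq a = m * (a * Complex.normSq a + (starRingEnd ℂ) a) := by
      rw [Complex.normSq_eq_conj_mul_self]
      linear_combination (-(starRingEnd ℂ) a) * ha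
    have h2 := congrArg Complex.im h1
    simp only [Complex.mul_im, Complex.add_im, Complex.conj_im, Complex.ofReal_im,
      Complex.ofReal_re, Complex.mul_re, Complex.re_ofNat, Complex.im_ofNat] at h2
    linarith
  have hn : Complex.normSq a ≤ 1 / 4 := by
    rw [Complex.normSq_eq_norm_sq]
    nlinarith [norm_nonneg a]
  have hn0 : 0 ≤ Complex.normSq a := Complex.normSq_nonneg a
  have hkim : (z - a * m).im = z.im - m * a.im := by
    simp only [Complex.sub_im, Complex.mul_im, Complex.ofReal_im, Complex.ofReal_re]
    ring
  refine ⟨a, z - a * m, rfl, by linear_combination -ha, ha2, ?_, fun h => ?_, fun h => ?_⟩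
  · have := norm_sub_norm_le z (a * m)
    rw [norm_mul, Complex.norm_real, Real.norm_of_nonneg hm.le] at this
    nlinarith
  · rw [hkim]
    have : 0 ≤ 2 * z.im * Complex.normSq a := by positivity
    rw [him] at this
    nlinarith
  · rw [hkim]
    have : 2 * z.im * Complex.normSq a ≤ 0 := mul_nonpos_of_nonpos_of_nonneg (by linarith) hn0
    rw [him] at this
    nlinarith

/-- `(u₁, u₂)` is a bounded `C¹` solution of `(D_m + V - z) u = (f₁, f₂)`. -/
structure IsClassicalSolution (m : ℝ) (V : ℝ → Matrix (Fin 2) (Fin 2) ℂ) (z : ℂ)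
    (u₁ u₂ f₁ f₂ : ℝ → ℂ) : Prop where
  bounded : ∃ b : ℝ, ∀ x, ‖u₁ x‖ ≤ b ∧ ‖u₂ x‖ ≤ b
  continuous_left : Continuous f₁
  continuous_right : Continuous f₂
  deriv_left : ∀ x, HasDerivAt u₁
    (Complex.I * ((z - V x 0 0) * u₁ x - (m + V x 0 1) * u₂ x + f₁ x)) x
  deriv_right : ∀ x, HasDerivAt u₂
    (-Complex.I * ((z - V x 1 1) * u₂ x - (m + V x 1 0) * u₁ x + f₂ x)) x

/-- Uniform sup bound for classical solutions at large non-real spectral parameter. -/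
lemma exists_norm_le_of_classicalSolution {m : ℝ} (hm : 0 < m)
    {V : ℝ → Matrix (Fin 2) (Fin 2) ℂ} {ω : ℝ → ℝ}
    (hVc : ∀ i j, Continuous fun x => V x i j) (hω : Integrable ω)
    (hV : ∀ x i j, ‖V x i j‖ ≤ ω x) :
    ∃ R K : ℝ, 0 < K ∧ ∀ (z : ℂ) (u₁ u₂ f₁ f₂ : ℝ → ℂ) (φ ψ : ℝ → ℝ), z.im ≠ 0 → R ≤ ‖z‖ →
      IsClassicalSolution m V z u₁ u₂ f₁ f₂ → IsMajorant φ ψ →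
      (∀ x, ‖f₁ x‖ ≤ φ x + ψ x) → (∀ x, ‖f₂ x‖ ≤ φ x + ψ x) →
      ∀ x, ‖u₁ x‖ ≤ K * sourceSize |z.im| φ ψ ∧ ‖u₂ x‖ ≤ K * sourceSize |z.im| φ ψ := by
  obtain ⟨R, K, hK, H⟩ := exists_norm_le_of_system hVc hω hV
  refine ⟨max (2 * m) (2 * R), 6 * K, by positivity, ?_⟩
  intro z u₁ u₂ f₁ f₂ φ ψ hz hzR hu hmaj hf₁ hf₂ x
  obtain ⟨b, hb⟩ := hu.bounded
  obtain ⟨a, k, hk, hka, ha, hkz, hpos, hneg⟩ :=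
    exists_diagonalization hm ((le_max_left _ _).trans hzR)
  have hkR : R ≤ ‖k‖ := by
    have := (le_max_right (2 * m) (2 * R)).trans hzR
    linarith
  have ha2 : ‖a ^ 2‖ ≤ 1 / 4 := by
    rw [norm_pow]
    nlinarith [norm_nonneg a]
  have hden : 1 / 2 ≤ ‖1 - a ^ 2‖ := by
    have := norm_sub_norm_le 1 (a ^ 2)
    rw [norm_one] at this
    linarith
  have hden0 : 1 - a ^ 2 ≠ 0 := by
    intro h
    rw [h, norm_zero] at hden
    norm_num at hden
  -- Inverse determinant of $(u_1,u_2)\mapsto(p,q)$; $|a|\le1/2$ keeps the change of variables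
  -- uniformly invertible.
  set c := (1 - a ^ 2)⁻¹ with hc
  have hcn : ‖c‖ ≤ 2 := by
    rw [hc, norm_inv]
    exact inv_le_of_inv_le₀ two_pos (by linarith)
  have hc1 : c * (1 - a ^ 2) = 1 := inv_mul_cancel₀ hden0
  have b1 : ‖c * a‖ ≤ 2 := by rw [norm_mul]; nlinarith [norm_nonneg a, norm_nonneg c]
  have b2 : ‖c * a ^ 2‖ ≤ 2 := by rw [norm_mul]; nlinarith [norm_nonneg (a ^ 2), norm_nonneg c]
  let p : ℝ → ℂ := fun x => u₁ x - a * u₂ x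
  let q : ℝ → ℂ := fun x => u₂ x - a * u₁ x
  have hu₁ : ∀ x, u₁ x = c * (p x + a * q x) := fun x => by
    simp only [p, q]
    linear_combination (-u₁ x) * hc1
  have hu₂ : ∀ x, u₂ x = c * (q x + a * p x) := fun x => by
    simp only [p, q]
    linear_combination (-u₂ x) * hc1
  let g : ℝ → ℂ := fun x => Complex.I * (f₁ x + a * f₂ x)
  let h : ℝ → ℂ := fun x => -Complex.I * (f₂ x + a * f₁ x)
  have hmix : ∀ s t : ℂ, ∀ C : ℝ, ‖s‖ ≤ C → ‖t‖ ≤ C → ‖s + a * t‖ ≤ 2 * C ∧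
      ‖s - a * t‖ ≤ 2 * C := by
    intro s t C hs ht
    have : ‖a * t‖ ≤ C := by
      rw [norm_mul]
      nlinarith [norm_nonneg t, norm_nonneg a]
    exact ⟨(norm_add_le _ _).trans (by linarith), (norm_sub_le _ _).trans (by linarith)⟩
  have hmaj2 := hmaj.const_mul (c := 2) zero_le_two
  have hg : ∀ x, ‖g x‖ ≤ 2 * φ x + 2 * ψ x := fun x => by
    simp only [g, norm_mul, Complex.norm_I, one_mul]
    linarith [(hmix _ _ _ (hf₁ x) (hf₂ x)).1]
  have hh : ∀ x, ‖h x‖ ≤ 2 * φ x + 2 * ψ x := fun x => by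
    simp only [h, norm_mul, norm_neg, Complex.norm_I, one_mul]
    linarith [(hmix _ _ _ (hf₂ x) (hf₁ x)).1]
  have hgc : Continuous g := by
    have := hu.continuous_left
    have := hu.continuous_right
    fun_prop
  have hhc : Continuous h := by
    have := hu.continuous_left
    have := hu.continuous_right
    fun_prop
  have hpb : ∀ x, ‖p x‖ ≤ 2 * b := fun x => (hmix _ _ _ (hb x).1 (hb x).2).2
  have hqb : ∀ x, ‖q x‖ ≤ 2 * b := fun x => (hmix _ _ _ (hb x).2 (hb x).1).2
  -- The potential in the variables $(p,q)$: each coupling is a linear form in the entries of $V$,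
  -- with coefficients depending on $z$ but bounded by $2$. Only this boundedness matters for
  -- uniformity.
  let cA : Matrix (Fin 2) (Fin 2) ℂ :=
    !![-Complex.I * c, -Complex.I * (c * a); -Complex.I * (c * a), -Complex.I * (c * a ^ 2)]
  let cB : Matrix (Fin 2) (Fin 2) ℂ :=
    !![-Complex.I * (c * a), -Complex.I * c; -Complex.I * (c * a ^ 2), -Complex.I * (c * a)]
  let cC : Matrix (Fin 2) (Fin 2) ℂ :=
    !![Complex.I * (c * a), Complex.I * (c * a ^ 2); Complex.I * c, Complex.I * (c * a)]
  let cD : Matrix (Fin 2) (Fin 2) ℂ :=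
    !![Complex.I * (c * a ^ 2), Complex.I * (c * a); Complex.I * (c * a), Complex.I * c]
  have hnI : ∀ w : ℂ, ‖w‖ ≤ 2 → ‖Complex.I * w‖ ≤ 2 ∧ ‖-Complex.I * w‖ ≤ 2 := fun w hw => by
    simpa using hw
  have hcA : ∀ i j, ‖cA i j‖ ≤ 2 := fun i j => by
    fin_cases i <;> fin_cases j
    exacts [(hnI _ hcn).2, (hnI _ b1).2, (hnI _ b1).2, (hnI _ b2).2]
  have hcB : ∀ i j, ‖cB i j‖ ≤ 2 := fun i j => by
    fin_cases i <;> fin_cases j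
    exacts [(hnI _ b1).2, (hnI _ hcn).2, (hnI _ b2).2, (hnI _ b1).2]
  have hcC : ∀ i j, ‖cC i j‖ ≤ 2 := fun i j => by
    fin_cases i <;> fin_cases j
    exacts [(hnI _ b1).1, (hnI _ b2).1, (hnI _ hcn).1, (hnI _ b1).1]
  have hcD : ∀ i j, ‖cD i j‖ ≤ 2 := fun i j => by
    fin_cases i <;> fin_cases j
    exacts [(hnI _ b2).1, (hnI _ b1).1, (hnI _ b1).1, (hnI _ hcn).1]
  have hp : ∀ x, HasDerivAt p
      ((Complex.I * k + lincomb cA (V x)) * p x + lincomb cB (V x) * q x + g x) x := fun x => by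
    refine ((hu.deriv_left x).sub ((hu.deriv_right x).const_mul a)).congr_deriv ?_
    have e1 : lincomb cA (V x) * p x + lincomb cB (V x) * q x =
        -Complex.I * ((V x 0 0 + a * V x 1 0) * u₁ x + (V x 0 1 + a * V x 1 1) * u₂ x) := by
      rw [hu₁, hu₂]
      simp [lincomb, Fin.sum_univ_two, cA, cB]
      ring
    have e2 : k * p x = (z - a * m) * u₁ x - (m - a * z) * u₂ x := by
      simp only [p]
      linear_combination (u₁ x) * hk - (u₂ x) * hka
    simp only [g]
    linear_combination -e1 - Complex.I * e2
  have hq : ∀ x, HasDerivAt q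
      ((-Complex.I * k + lincomb cD (V x)) * q x + lincomb cC (V x) * p x + h x) x := fun x => by
    refine ((hu.deriv_right x).sub ((hu.deriv_left x).const_mul a)).congr_deriv ?_
    have e1 : lincomb cD (V x) * q x + lincomb cC (V x) * p x =
        Complex.I * ((V x 1 1 + a * V x 0 1) * u₂ x + (V x 1 0 + a * V x 0 0) * u₁ x) := by
      rw [hu₁, hu₂]
      simp [lincomb, Fin.sum_univ_two, cC, cD]
      ring
    have e2 : k * q x = (z - a * m) * u₂ x - (m - a * z) * u₁ x := by
      simp only [q]
      linear_combination (u₂ x) * hk - (u₁ x) * hka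
    simp only [h]
    linear_combination -e1 + Complex.I * e2
  have hpq : ‖p x‖ ≤ K * (2 * sourceSize |z.im| φ ψ) ∧
      ‖q x‖ ≤ K * (2 * sourceSize |z.im| φ ψ) := by
    rw [← sourceSize_const_mul zero_le_two]
    have hz' : 0 < |z.im| := abs_pos.2 hz
    rcases lt_or_gt_of_ne hz with hlt | hgt
    -- In the lower half-plane $-k$ has positive imaginary part, so $p$ and $q$ exchange roles.
    · have hk' := hneg hlt
      have habs : |z.im| ≤ (-k).im := by
        rw [abs_of_neg hlt, Complex.neg_im]
        linarith
      obtain ⟨h1, h2⟩ := H (-k) cD cC cB cA h g q p _ _ (2 * b) (hz'.trans_le habs)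
        (by rwa [norm_neg]) hcD hcC hcB hcA hhc hgc hmaj2 hh hg hqb hpb
        (fun x => (hq x).congr_deriv (by ring)) (fun x => (hp x).congr_deriv (by ring)) x
      have := mul_le_mul_of_nonneg_left
        (sourceSize_anti hz' habs (fun x => 2 * φ x) (fun x => 2 * ψ x)) hK.le
      exact ⟨h2.trans this, h1.trans this⟩
    · have hk' := hpos hgt
      have habs : |z.im| ≤ k.im := by rwa [abs_of_pos hgt]
      obtain ⟨h1, h2⟩ := H k cA cB cC cD g h p q _ _ (2 * b) (hz'.trans_le habs)
        hkR hcA hcB hcC hcD hgc hhc hmaj2 hg hh hpb hqb hp hq x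
      have := mul_le_mul_of_nonneg_left
        (sourceSize_anti hz' habs (fun x => 2 * φ x) (fun x => 2 * ψ x)) hK.le
      exact ⟨h1.trans this, h2.trans this⟩
  have hN0 : 0 ≤ sourceSize |z.im| φ ψ := sourceSize_nonneg hmaj
  have hfin : ∀ s t : ℂ, ‖s‖ ≤ K * (2 * sourceSize |z.im| φ ψ) →
      ‖t‖ ≤ K * (2 * sourceSize |z.im| φ ψ) →
      ‖c * (s + a * t)‖ ≤ 6 * K * sourceSize |z.im| φ ψ := by
    intro s t hs ht
    have h1 : ‖s + a * t‖ ≤ 3 / 2 * (K * (2 * sourceSize |z.im| φ ψ)) := by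
      refine (norm_add_le _ _).trans ?_
      rw [norm_mul]
      have := mul_le_mul ha ht (norm_nonneg _) (by norm_num)
      linarith
    rw [norm_mul]
    have := mul_le_mul hcn h1 (norm_nonneg _) zero_le_two
    linarith
  rw [hu₁, hu₂]
  exact ⟨hfin _ _ hpq.1 hpq.2, hfin _ _ hpq.2 hpq.1⟩

/-! ### Schwartz functions form a core for the derivative -/

/-- A Schwartz spinor as an element of `L²`. -/
def toL2 (φ : 𝓢(ℝ, Spinor)) : SpinorL2 := φ.toLp 2 volume

lemma toL2_add (φ χ : 𝓢(ℝ, Spinor)) : toL2 (φ + χ) = toL2 φ + toL2 χ :=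
  map_add (SchwartzMap.toLpCLM ℂ Spinor 2 (volume : Measure ℝ)) φ χ

lemma toL2_smul (c : ℂ) (φ : 𝓢(ℝ, Spinor)) : toL2 (c • φ) = c • toL2 φ :=
  map_smul (SchwartzMap.toLpCLM ℂ Spinor 2 (volume : Measure ℝ)) c φ

lemma coeFn_toL2 (φ : 𝓢(ℝ, Spinor)) : toL2 φ =ᵐ[volume] φ := φ.coeFn_toLp 2 volume

lemma denseRange_toL2 : DenseRange toL2 :=
  SchwartzMap.denseRange_toLpCLM (E := ℝ) (F := Spinor) (p := 2) (by simp) (μ := volume)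

lemma hasDistribDeriv_toL2 (φ : 𝓢(ℝ, Spinor)) :
    HasDistribDeriv (toL2 φ) (toL2 (∂_{(1 : ℝ)} φ)) := by
  unfold HasDistribDeriv toL2
  rw [Lp.toTemperedDistribution_toLp_eq, Lp.toTemperedDistribution_toLp_eq]
  exact TemperedDistribution.lineDerivOp_toTemperedDistributionCLM_eq φ 1

/-- Closedness of $\partial_x$: pairing with a fixed test function is continuous on $L^2$. -/
lemma HasDistribDeriv.of_tendsto {u g : SpinorL2} {un gn : ℕ → SpinorL2}
    (h : ∀ n, HasDistribDeriv (un n) (gn n)) (hu : Tendsto un atTop (𝓝 u))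
    (hg : Tendsto gn atTop (𝓝 g)) : HasDistribDeriv u g := by
  have h1 : ∀ v : ℕ → SpinorL2, ∀ w, Tendsto v atTop (𝓝 w) → ∀ η : 𝓢(ℝ, ℂ),
      Tendsto (fun n => (v n : 𝓢'(ℝ, Spinor)) η) atTop (𝓝 ((w : 𝓢'(ℝ, Spinor)) η)) := by
    intro v w hv η
    have h2 := ((Lp.toTemperedDistributionCLM Spinor (volume : Measure ℝ) 2).continuous.tendsto
      w).comp hv
    exact ((PointwiseConvergenceCLM.evalCLM (σ := RingHom.id ℂ) Spinor η).continuous.tendsto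
      _).comp h2
  unfold HasDistribDeriv
  ext1 η
  refine tendsto_nhds_unique (h1 un u hu (-∂_{(1 : ℝ)} η)) ((h1 gn g hg η).congr fun n => ?_)
  exact (congrArg (fun T : 𝓢'(ℝ, Spinor) => T η) (h n)).symm

lemma lineDerivOp_postcompCLM {F G : Type*} [NormedAddCommGroup F] [NormedSpace ℝ F]
    [NormedAddCommGroup G] [NormedSpace ℝ G] (L : F →L[ℝ] G) (η : 𝓢(ℝ, F)) (v : ℝ) :
    ∂_{v} (η.postcompCLM L) = (∂_{v} η).postcompCLM L := by
  ext x
  rw [SchwartzMap.postcompCLM_apply, SchwartzMap.lineDerivOp_apply_eq_fderiv,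
    SchwartzMap.lineDerivOp_apply_eq_fderiv]
  have : (⇑(η.postcompCLM L) : ℝ → G) = L ∘ η := rfl
  rw [this, fderiv_comp x L.differentiableAt η.differentiableAt, L.fderiv]
  rfl

lemma inner_toL2 (φ : 𝓢(ℝ, Spinor)) (u : SpinorL2) :
    inner ℂ (toL2 φ) u = ∫ x, inner ℂ (φ x) (u x) := by
  rw [L2.inner_def]
  refine integral_congr_ae ?_
  filter_upwards [coeFn_toL2 φ] with x hx
  rw [hx]

lemma integrable_schwartz_smul (η : 𝓢(ℝ, ℂ)) (w : SpinorL2) :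
    Integrable fun x => η x • w x :=
  memLp_one_iff_integrable.1 ((Lp.memLp w).smul (η.memLp 2 volume))

/-- A weak form of the derivative, tested against Schwartz spinors in the inner product. -/
lemma hasDistribDeriv_of_inner {u g : SpinorL2}
    (h : ∀ χ : 𝓢(ℝ, Spinor), inner ℂ (toL2 (∂_{(1 : ℝ)} χ)) u = -inner ℂ (toL2 χ) g) :
    HasDistribDeriv u g := by
  unfold HasDistribDeriv
  ext1 η
  rw [TemperedDistribution.lineDerivOp_apply_apply, Lp.toTemperedDistribution_apply,
    Lp.toTemperedDistribution_apply]
  refine ext_inner_left ℂ fun v => ?_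
  rw [← integral_inner (integrable_schwartz_smul _ _), ← integral_inner (integrable_schwartz_smul _ _)]
  -- The map $c\mapsto\bar c\,v$ turns a scalar test function into a spinor one; the conjugation
  -- compensates for the conjugate-linear first slot of the inner product, so `L` is only
  -- real-linear.
  let L : ℂ →L[ℝ] Spinor :=
    ((ContinuousLinearMap.toSpanSingleton ℂ v).restrictScalars ℝ).comp
      (Complex.conjCLE : ℂ →L[ℝ] ℂ)
  have hL : ∀ (θ : 𝓢(ℝ, ℂ)) (w : SpinorL2),
      ∫ x, inner ℂ v (θ x • w x) = inner ℂ (toL2 (θ.postcompCLM L)) w := by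
    intro θ w
    rw [inner_toL2]
    refine integral_congr_ae (Eventually.of_forall fun x => ?_)
    simp [L, SchwartzMap.postcompCLM_apply, mul_comm]
  rw [hL, hL, map_neg, ← lineDerivOp_postcompCLM]
  have := h (η.postcompCLM L)
  rw [← neg_eq_iff_eq_neg, ← inner_neg_left] at this
  rw [← this]
  congr 1

lemma inner_toL2_lineDerivOp (φ χ : 𝓢(ℝ, Spinor)) :
    inner ℂ (toL2 φ) (toL2 (∂_{(1 : ℝ)} χ)) = -inner ℂ (toL2 (∂_{(1 : ℝ)} φ)) (toL2 χ) := by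
  have hL : ∀ φ χ : 𝓢(ℝ, Spinor), inner ℂ (toL2 φ) (toL2 χ) = ∫ x, inner ℂ (φ x) (χ x) := by
    intro φ χ
    rw [inner_toL2]
    refine integral_congr_ae ?_
    filter_upwards [coeFn_toL2 χ] with x hx
    rw [hx]
  rw [hL, hL]
  exact SchwartzMap.integral_bilinear_lineDerivOp_right_eq_neg_left φ χ
    (isBoundedBilinearMap_inner (𝕜 := ℂ) (E := Spinor)).toContinuousLinearMap 1

lemma hasTemperateGrowth_resolvent_symbol (c : ℂ) :
    Function.HasTemperateGrowth
      (fun ξ : ℝ => (c - Complex.I * ξ) * ((1 + ‖ξ‖ ^ 2) ^ (-1 : ℝ) : ℝ)) := by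
  fun_prop

/-- In Fourier variables $\partial_x+2\pi c$ is multiplication by $2\pi(c+i\xi)$. Since $c^2=1$, its
inverse $(2\pi)^{-1}(c-i\xi)/(1+\xi^2)$ is smooth of temperate growth and preserves Schwartz
functions. -/
lemma exists_lineDerivOp_add_eq {F : Type*} [NormedAddCommGroup F] [NormedSpace ℂ F]
    [CompleteSpace F] {c : ℂ} (hc : c ^ 2 = 1) (ψ : 𝓢(ℝ, F)) :
    ∃ φ : 𝓢(ℝ, F), ∂_{(1 : ℝ)} φ + (2 * Real.pi * c) • φ = ψ := by
  let s : ℝ → ℂ := fun ξ => (c - Complex.I * ξ) * ((1 + ‖ξ‖ ^ 2) ^ (-1 : ℝ) : ℝ)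
  have hs : s.HasTemperateGrowth := hasTemperateGrowth_resolvent_symbol c
  have hi : (fun ξ : ℝ => ((inner ℝ ξ 1 : ℝ) : ℂ)).HasTemperateGrowth := by fun_prop
  refine ⟨(2 * Real.pi : ℂ)⁻¹ • SchwartzMap.fourierMultiplierCLM F s ψ, ?_⟩
  have h0 : (2 * Real.pi : ℂ) ≠ 0 := by simp [Real.pi_ne_zero]
  rw [LineDeriv.lineDerivOp_smul, SchwartzMap.lineDeriv_eq_fourierMultiplierCLM,
    ← SchwartzMap.fourierMultiplierCLM_ofReal ℂ (by fun_prop)]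
  have hmul := SchwartzMap.fourierMultiplierCLM_fourierMultiplierCLM_apply hi hs ψ
  have hmul' : SchwartzMap.fourierMultiplierCLM F (fun ξ : ℝ => RCLike.ofReal (K := ℂ) (inner ℝ ξ 1))
      (SchwartzMap.fourierMultiplierCLM F s ψ) = _ := hmul
  rw [hmul', smul_smul, smul_smul, inv_mul_cancel_left₀ h0, mul_assoc,
    mul_comm c, mul_inv_cancel_left₀ h0]
  have hsum : Complex.I • ((fun ξ : ℝ => ((inner ℝ ξ 1 : ℝ) : ℂ)) * s) + c • s = fun _ => 1 := by
    ext ξ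
    have hp : (0 : ℝ) < 1 + ‖ξ‖ ^ 2 := by positivity
    have hpc : (1 : ℂ) + (ξ : ℂ) ^ 2 ≠ 0 := by
      have : (0 : ℝ) < 1 + ξ ^ 2 := by positivity
      exact_mod_cast this.ne'
    simp only [s, Pi.add_apply, Pi.smul_apply, Pi.mul_apply, smul_eq_mul, Real.rpow_neg_one]
    simp only [RCLike.inner_apply, Real.norm_eq_abs, sq_abs]
    push_cast
    simp
    field_simp
    ring_nf
    simp [hc]
  have hadd : SchwartzMap.fourierMultiplierCLM F
      (Complex.I • ((fun ξ : ℝ => ((inner ℝ ξ 1 : ℝ) : ℂ)) * s) + c • s) ψ =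
      Complex.I • SchwartzMap.fourierMultiplierCLM F
        ((fun ξ : ℝ => ((inner ℝ ξ 1 : ℝ) : ℂ)) * s) ψ +
      c • SchwartzMap.fourierMultiplierCLM F s ψ := by
    have hI : (Complex.I • ((fun ξ : ℝ => ((inner ℝ ξ 1 : ℝ) : ℂ)) * s)).HasTemperateGrowth :=
      (Function.HasTemperateGrowth.const Complex.I).mul (hi.mul hs)
    have hC : (c • s).HasTemperateGrowth := (Function.HasTemperateGrowth.const c).mul hs
    simp only [SchwartzMap.fourierMultiplierCLM_apply, SchwartzMap.smulLeftCLM_add hI hC,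
      SchwartzMap.smulLeftCLM_smul (hi.mul hs), SchwartzMap.smulLeftCLM_smul hs,
      _root_.add_apply, _root_.smul_apply,
      FourierTransform.fourierInv_add, FourierTransform.fourierInv_smul]
  rw [← hadd, hsum, SchwartzMap.fourierMultiplierCLM_const]
  simp

/-- Approximate solvability of `T φ = f` together with convergence of `j φ`, when `T` has dense
range and controls `j`. -/
lemma exists_seq_tendsto_of_denseRange {S E : Type*} [AddCommGroup S] [Module ℂ S]
    [NormedAddCommGroup E] [NormedSpace ℂ E] [CompleteSpace E] (T j : S →ₗ[ℂ] E) {C : ℝ}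
    (hC : ∀ φ, ‖j φ‖ ≤ C * ‖T φ‖) (hT : DenseRange T) (f : E) :
    ∃ (φ : ℕ → S) (u : E), Tendsto (fun n => T (φ n)) atTop (𝓝 f) ∧
      Tendsto (fun n => j (φ n)) atTop (𝓝 u) := by
  obtain ⟨x, hx, hxf⟩ := mem_closure_iff_seq_limit.1 (hT f)
  choose φ hφ using hx
  have hTf : Tendsto (fun n => T (φ n)) atTop (𝓝 f) := by simpa only [hφ] using hxf
  have hcau : CauchySeq fun n => j (φ n) := by
    have h1 := hTf.cauchySeq
    rw [Metric.cauchySeq_iff'] at h1 ⊢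
    intro ε hε
    obtain ⟨N, hN⟩ := h1 (ε / (|C| + 1)) (by positivity)
    refine ⟨N, fun n hn => ?_⟩
    have h2 := hN n hn
    rw [dist_eq_norm, ← map_sub] at h2 ⊢
    rw [lt_div_iff₀ (by positivity)] at h2
    calc ‖j (φ n - φ N)‖ ≤ C * ‖T (φ n - φ N)‖ := hC _
      _ ≤ ‖T (φ n - φ N)‖ * (|C| + 1) := by
          nlinarith [norm_nonneg (T (φ n - φ N)), le_abs_self C]
      _ < ε := h2
  obtain ⟨u, hu⟩ := cauchySeq_tendsto_of_complete hcau
  exact ⟨φ, u, hTf, hu⟩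

/-- `toL2` as a linear map. -/
def toL2Lin : 𝓢(ℝ, Spinor) →ₗ[ℂ] SpinorL2 where
  toFun := toL2
  map_add' := toL2_add
  map_smul' := toL2_smul

/-- The derivative of Schwartz spinors, as a linear map into `L²`. -/
def derivL2Lin : 𝓢(ℝ, Spinor) →ₗ[ℂ] SpinorL2 where
  toFun φ := toL2 (∂_{(1 : ℝ)} φ)
  map_add' φ χ := by rw [LineDeriv.lineDerivOp_add, toL2_add]
  map_smul' c φ := by rw [LineDeriv.lineDerivOp_smul, toL2_smul]; rfl

/-- Since $\partial_x$ is skew-symmetric,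
$\operatorname{Re}\langle\varphi,\varphi'+c\varphi\rangle=c\|\varphi\|^2$. -/
lemma norm_toL2_le_of_deriv_add (φ : 𝓢(ℝ, Spinor)) {c : ℝ} (hc : 0 < c) :
    ‖toL2 φ‖ ≤ c⁻¹ * ‖toL2 (∂_{(1 : ℝ)} φ) + (c : ℂ) • toL2 φ‖ := by
  have h1 := inner_toL2_lineDerivOp φ φ
  have h2 : (inner ℂ (toL2 φ) (toL2 (∂_{(1 : ℝ)} φ))).re = 0 := by
    have h3 := congrArg Complex.re h1
    rw [← inner_conj_symm (toL2 (∂_{(1 : ℝ)} φ))] at h3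
    simp only [Complex.neg_re, Complex.conj_re] at h3
    linarith
  have h4 : (inner ℂ (toL2 φ) (toL2 (∂_{(1 : ℝ)} φ) + (c : ℂ) • toL2 φ)).re
      = c * ‖toL2 φ‖ ^ 2 := by
    have h3 : inner ℂ (toL2 φ) (toL2 φ) = ((‖toL2 φ‖ ^ 2 : ℝ) : ℂ) := by
      rw [inner_self_eq_norm_sq_to_K]
      push_cast
      rfl
    rw [inner_add_right, Complex.add_re, h2, inner_smul_right, h3, ← Complex.ofReal_mul,
      Complex.ofReal_re, zero_add]
  have h5 := (Complex.re_le_norm _).trans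
    (norm_inner_le_norm (𝕜 := ℂ) (toL2 φ) (toL2 (∂_{(1 : ℝ)} φ) + (c : ℂ) • toL2 φ))
  rw [h4] at h5
  rw [inv_mul_eq_div, le_div_iff₀ hc]
  rcases (norm_nonneg (toL2 φ)).eq_or_lt with h0 | h0
  · rw [← h0, zero_mul]
    exact norm_nonneg _
  · nlinarith

/-- By duality: every test function has the form $\theta'-2\pi c\,\theta$ with $\theta$ Schwartz,
and $v$ annihilates all of these. -/
lemma eq_zero_of_hasDistribDeriv_smul {v : SpinorL2} {c : ℂ} (hc : c ^ 2 = 1)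
    (h : HasDistribDeriv v (-(2 * Real.pi * c) • v)) : v = 0 := by
  refine LinearMap.ker_eq_bot'.1 (Lp.ker_toTemperedDistributionCLM_eq_bot
    (F := Spinor) (μ := (volume : Measure ℝ)) (p := 2)) v ?_
  ext1 η
  obtain ⟨θ, hθ⟩ := exists_lineDerivOp_add_eq (c := -c) (by simpa using hc) η
  have h1 := congrArg (fun T : 𝓢'(ℝ, Spinor) => T θ) h
  simp only [TemperedDistribution.lineDerivOp_apply_apply, ← Lp.toTemperedDistributionCLM_apply,
    map_smul] at h1
  rw [← hθ, map_add, map_smul]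
  have h2 : (Lp.toTemperedDistributionCLM Spinor (volume : Measure ℝ) 2 v) (∂_{(1 : ℝ)} θ) =
      (2 * Real.pi * c) • (Lp.toTemperedDistributionCLM Spinor (volume : Measure ℝ) 2 v) θ := by
    rw [map_neg] at h1
    rw [← neg_inj, h1]
    simp
  simp only [ContinuousLinearMap.coe_coe]
  rw [h2, ← add_smul]
  simp

/-- Schwartz spinors are dense in `H¹` for the graph norm of the derivative. -/
lemma HasDistribDeriv.exists_schwartz_tendsto {u g : SpinorL2} (h : HasDistribDeriv u g) :
    ∃ φ : ℕ → 𝓢(ℝ, Spinor), Tendsto (fun n => toL2 (φ n)) atTop (𝓝 u) ∧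
      Tendsto (fun n => toL2 (∂_{(1 : ℝ)} (φ n))) atTop (𝓝 g) := by
  set c : ℂ := ((2 * Real.pi : ℝ) : ℂ) with hc
  have hc' : c = 2 * Real.pi * 1 := by rw [hc]; push_cast; ring
  have hT : DenseRange (derivL2Lin + c • toL2Lin) := by
    refine denseRange_toL2.mono ?_
    rintro _ ⟨ψ, rfl⟩
    obtain ⟨φ, hφ⟩ := exists_lineDerivOp_add_eq (c := 1) (by simp) ψ
    refine ⟨φ, ?_⟩
    rw [← hφ, toL2_add, toL2_smul, ← hc']
    rfl
  -- The equation $(\partial_x+c)\varphi=g+cu$ is solved approximately by Schwartz functions. Their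
  -- limit $w$ solves the same equation as $u$, and uniqueness identifies the two.
  obtain ⟨φ, w, hφ, hw⟩ := exists_seq_tendsto_of_denseRange (derivL2Lin + c • toL2Lin) toL2Lin
    (fun φ => norm_toL2_le_of_deriv_add φ Real.two_pi_pos) hT (g + c • u)
  have hd : Tendsto (fun n => toL2 (∂_{(1 : ℝ)} (φ n))) atTop (𝓝 (g + c • u - c • w)) := by
    refine (hφ.sub (hw.const_smul c)).congr fun n => ?_
    change toL2 (∂_{(1 : ℝ)} (φ n)) + c • toL2 (φ n) - c • toL2 (φ n) = _
    rw [add_sub_cancel_right]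
  have hwd : HasDistribDeriv w (g + c • u - c • w) :=
    HasDistribDeriv.of_tendsto (fun n => hasDistribDeriv_toL2 (φ n)) hw hd
  have hwu : w - u = 0 := by
    refine eq_zero_of_hasDistribDeriv_smul (c := 1) (by simp) ?_
    have := hwd.add (h.smul (-1))
    convert this using 1
    · simp [sub_eq_add_neg]
    · rw [← hc']
      simp only [neg_smul, one_smul, smul_sub]
      abel
  rw [sub_eq_zero] at hwu
  subst hwu
  exact ⟨φ, hw, by simpa using hd⟩

/-! ### The Dirac operator on `H¹` -/

lemma coeFn_constMatrix (A : Matrix (Fin 2) (Fin 2) ℂ) (u : SpinorL2) :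
    constMatrix A u =ᵐ[volume]
      fun x => Matrix.toEuclideanCLM (n := Fin 2) (𝕜 := ℂ) A (u x) :=
  ContinuousLinearMap.coeFn_compLpL _ u

lemma inner_toEuclideanCLM_left (A : Matrix (Fin 2) (Fin 2) ℂ) (v w : Spinor) :
    inner ℂ (Matrix.toEuclideanCLM (n := Fin 2) (𝕜 := ℂ) A v) w =
      inner ℂ v (Matrix.toEuclideanCLM (n := Fin 2) (𝕜 := ℂ) A.conjTranspose w) := by
  rw [← Matrix.star_eq_conjTranspose, map_star, ContinuousLinearMap.star_eq_adjoint,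
    ContinuousLinearMap.adjoint_inner_right]

lemma inner_constMatrix_left (A : Matrix (Fin 2) (Fin 2) ℂ) (u v : SpinorL2) :
    inner ℂ (constMatrix A u) v = inner ℂ u (constMatrix A.conjTranspose v) := by
  rw [L2.inner_def, L2.inner_def]
  refine integral_congr_ae ?_
  filter_upwards [coeFn_constMatrix A u, coeFn_constMatrix A.conjTranspose v] with x h1 h2
  rw [h1, h2, inner_toEuclideanCLM_left]

lemma constMatrix_constMatrix (A B : Matrix (Fin 2) (Fin 2) ℂ) (u : SpinorL2) :
    constMatrix A (constMatrix B u) = constMatrix (A * B) u := by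
  refine Lp.ext ?_
  filter_upwards [coeFn_constMatrix A (constMatrix B u), coeFn_constMatrix B u,
    coeFn_constMatrix (A * B) u] with x h1 h2 h3
  rw [h1, h2, h3, map_mul]
  rfl

lemma constMatrix_one (u : SpinorL2) : constMatrix 1 u = u := by
  refine Lp.ext ?_
  filter_upwards [coeFn_constMatrix 1 u] with x h1
  rw [h1, map_one]
  rfl

lemma alpha_mul_alpha : alpha * alpha = 1 := by
  simp [alpha, Matrix.one_fin_two]

lemma conjTranspose_alpha : alpha.conjTranspose = alpha := by
  ext i j
  fin_cases i <;> fin_cases j <;> simp [alpha]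

lemma conjTranspose_beta : beta.conjTranspose = beta := by
  ext i j
  fin_cases i <;> fin_cases j <;> simp [beta]

lemma constMatrix_alpha_alpha (u : SpinorL2) : constMatrix alpha (constMatrix alpha u) = u := by
  rw [constMatrix_constMatrix, alpha_mul_alpha, constMatrix_one]

lemma HasDistribDeriv.constMatrix {u g : SpinorL2} (A : Matrix (Fin 2) (Fin 2) ℂ)
    (h : HasDistribDeriv u g) :
    HasDistribDeriv (Dirac1D.constMatrix A u) (Dirac1D.constMatrix A g) := by
  have key : ∀ (w : SpinorL2) (η : 𝓢(ℝ, ℂ)),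
      ((Dirac1D.constMatrix A w : SpinorL2) : 𝓢'(ℝ, Spinor)) η =
      Matrix.toEuclideanCLM (n := Fin 2) (𝕜 := ℂ) A ((w : 𝓢'(ℝ, Spinor)) η) := by
    intro w η
    rw [Lp.toTemperedDistribution_apply, Lp.toTemperedDistribution_apply,
      ← ContinuousLinearMap.integral_comp_comm _ (integrable_schwartz_smul η w)]
    refine integral_congr_ae ?_
    filter_upwards [coeFn_constMatrix A w] with x hx
    rw [hx, map_smul]
  unfold HasDistribDeriv
  ext1 η
  rw [TemperedDistribution.lineDerivOp_apply_apply, key, key]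
  exact congrArg _ (congrArg (fun T : 𝓢'(ℝ, Spinor) => T η) h)

/-- Integration by parts on $H^1$, carried over from Schwartz spinors by graph-norm density. -/
lemma HasDistribDeriv.inner_eq_neg {u v g h : SpinorL2} (hu : HasDistribDeriv u g)
    (hv : HasDistribDeriv v h) : inner ℂ u h = -inner ℂ g v := by
  obtain ⟨φ, h1, h2⟩ := hu.exists_schwartz_tendsto
  obtain ⟨χ, h3, h4⟩ := hv.exists_schwartz_tendsto
  refine tendsto_nhds_unique (h1.inner h4) ?_
  exact (h2.inner h3).neg.congr fun n => (inner_toL2_lineDerivOp _ _).symm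

/-- A continuous matrix potential with a bounded integrable majorant. -/
structure IsPotential (V : ℝ → Matrix (Fin 2) (Fin 2) ℂ) (ω : ℝ → ℝ) : Prop where
  continuous : ∀ i j, Continuous fun x => V x i j
  integrable : Integrable ω
  norm_le : ∀ x i j, ‖V x i j‖ ≤ ω x
  bounded : ∃ b, ∀ x, ω x ≤ b

lemma IsPotential.conjTranspose {V : ℝ → Matrix (Fin 2) (Fin 2) ℂ} {ω : ℝ → ℝ}
    (h : IsPotential V ω) : IsPotential (fun x => (V x).conjTranspose) ω where
  continuous i j := by
    simp only [Matrix.conjTranspose_apply]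
    exact (h.continuous j i).star
  integrable := h.integrable
  norm_le x i j := by
    rw [Matrix.conjTranspose_apply, norm_star]
    exact h.norm_le x j i
  bounded := h.bounded

lemma IsPotential.nonneg {V : ℝ → Matrix (Fin 2) (Fin 2) ℂ} {ω : ℝ → ℝ} (h : IsPotential V ω)
    (x : ℝ) : 0 ≤ ω x := (norm_nonneg _).trans (h.norm_le x 0 0)

lemma IsPotential.memLp_two {V : ℝ → Matrix (Fin 2) (Fin 2) ℂ} {ω : ℝ → ℝ}
    (h : IsPotential V ω) : MemLp ω 2 := by
  obtain ⟨b, hb⟩ := h.bounded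
  refine (memLp_two_iff_integrable_sq h.integrable.aestronglyMeasurable).2 ?_
  refine (h.integrable.const_mul b).mono' (h.integrable.aestronglyMeasurable.pow 2)
    (Eventually.of_forall fun x => ?_)
  have h0 := h.nonneg x
  rw [Real.norm_of_nonneg (by positivity), sq]
  exact mul_le_mul_of_nonneg_right (hb x) h0

lemma norm_spinor_le {v : Spinor} {b : ℝ} (h : ∀ i, ‖v i‖ ≤ b) : ‖v‖ ≤ 2 * b := by
  have hb : 0 ≤ b := (norm_nonneg _).trans (h 0)
  rw [EuclideanSpace.norm_eq, Real.sqrt_le_left (by positivity), Fin.sum_univ_two]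
  have h0 := pow_le_pow_left₀ (norm_nonneg _) (h 0) 2
  have h1 := pow_le_pow_left₀ (norm_nonneg _) (h 1) 2
  nlinarith

lemma toEuclideanCLM_apply_two (A : Matrix (Fin 2) (Fin 2) ℂ) (v : Spinor) (i : Fin 2) :
    Matrix.toEuclideanCLM (n := Fin 2) (𝕜 := ℂ) A v i = A i 0 * v 0 + A i 1 * v 1 := by
  rw [Matrix.ofLp_toEuclideanCLM]
  simp [Matrix.mulVec, dotProduct, Fin.sum_univ_two]

lemma norm_toEuclideanCLM_apply_le {A : Matrix (Fin 2) (Fin 2) ℂ} {b : ℝ}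
    (h : ∀ i j, ‖A i j‖ ≤ b) (v : Spinor) :
    ‖Matrix.toEuclideanCLM (n := Fin 2) (𝕜 := ℂ) A v‖ ≤ 4 * b * ‖v‖ := by
  have hb : 0 ≤ b := (norm_nonneg _).trans (h 0 0)
  have : ∀ i, ‖Matrix.toEuclideanCLM (n := Fin 2) (𝕜 := ℂ) A v i‖ ≤ 2 * b * ‖v‖ := by
    intro i
    rw [toEuclideanCLM_apply_two]
    refine (norm_add_le _ _).trans ?_
    rw [norm_mul, norm_mul]
    have h0 := mul_le_mul (h i 0) (PiLp.norm_apply_le v 0) (norm_nonneg _) hb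
    have h1 := mul_le_mul (h i 1) (PiLp.norm_apply_le v 1) (norm_nonneg _) hb
    linarith
  linarith [norm_spinor_le this]

lemma aestronglyMeasurable_mulFun {V : ℝ → Matrix (Fin 2) (Fin 2) ℂ} {ω : ℝ → ℝ}
    (h : IsPotential V ω) (u : SpinorL2) : AEStronglyMeasurable (mulFun V u) volume := by
  have hu : ∀ j, AEStronglyMeasurable (fun x => u x j) volume := fun j =>
    (EuclideanSpace.proj (𝕜 := ℂ) j).continuous.comp_aestronglyMeasurable
      (Lp.aestronglyMeasurable u)
  have h1 : AEStronglyMeasurable (fun x => (WithLp.ofLp (mulFun V u x) : Fin 2 → ℂ)) volume := by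
    refine (aemeasurable_pi_lambda _ fun i => ?_).aestronglyMeasurable
    simp only [mulFun, toEuclideanCLM_apply_two]
    exact (((h.continuous i 0).aestronglyMeasurable.mul (hu 0)).add
      ((h.continuous i 1).aestronglyMeasurable.mul (hu 1))).aemeasurable
  exact (PiLp.continuous_toLp 2 _).comp_aestronglyMeasurable h1

lemma norm_mulFun_le {V : ℝ → Matrix (Fin 2) (Fin 2) ℂ} {ω : ℝ → ℝ}
    (h : IsPotential V ω) (u : SpinorL2) (x : ℝ) : ‖mulFun V u x‖ ≤ 4 * ω x * ‖u x‖ :=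
  norm_toEuclideanCLM_apply_le (h.norm_le x) (u x)

lemma memLp_mulFun {V : ℝ → Matrix (Fin 2) (Fin 2) ℂ} {ω : ℝ → ℝ}
    (h : IsPotential V ω) (u : SpinorL2) : MemLp (mulFun V u) 2 := by
  obtain ⟨b, hb⟩ := h.bounded
  refine (Lp.memLp u).of_le_mul (c := 4 * b) (aestronglyMeasurable_mulFun h u)
    (Eventually.of_forall fun x => (norm_mulFun_le h u x).trans ?_)
  gcongr
  exact hb x

/-- Multiplication by a bounded potential, as a bounded operator. -/
def mulCLM {V : ℝ → Matrix (Fin 2) (Fin 2) ℂ} {ω : ℝ → ℝ} (h : IsPotential V ω) :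
    SpinorL2 →L[ℂ] SpinorL2 :=
  LinearMap.mkContinuousOfExistsBound
    { toFun := fun u => mulOp V ⟨u, memLp_mulFun h u⟩
      map_add' := fun u v => (mulOp V).map_add ⟨u, memLp_mulFun h u⟩ ⟨v, memLp_mulFun h v⟩
      map_smul' := fun c u => (mulOp V).map_smul c ⟨u, memLp_mulFun h u⟩ } <| by
    obtain ⟨b, hb⟩ := h.bounded
    refine ⟨4 * b, fun u => Lp.norm_le_mul_norm_of_ae_le_mul ?_⟩
    filter_upwards [(memLp_mulFun h u).coeFn_toLp] with x hx
    change ‖(memLp_mulFun h u).toLp _ x‖ ≤ _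
    rw [hx]
    refine (norm_mulFun_le h u x).trans ?_
    gcongr
    exact hb x

lemma mulCLM_apply {V : ℝ → Matrix (Fin 2) (Fin 2) ℂ} {ω : ℝ → ℝ} (h : IsPotential V ω)
    (u : SpinorL2) : mulCLM h u = mulOp V ⟨u, memLp_mulFun h u⟩ := rfl

lemma coeFn_mulCLM {V : ℝ → Matrix (Fin 2) (Fin 2) ℂ} {ω : ℝ → ℝ} (h : IsPotential V ω)
    (u : SpinorL2) : mulCLM h u =ᵐ[volume] mulFun V u :=
  (memLp_mulFun h u).coeFn_toLp

lemma inner_mulCLM_left {V : ℝ → Matrix (Fin 2) (Fin 2) ℂ} {ω : ℝ → ℝ} (h : IsPotential V ω)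
    (u v : SpinorL2) : inner ℂ (mulCLM h u) v = inner ℂ u (mulCLM h.conjTranspose v) := by
  rw [L2.inner_def, L2.inner_def]
  refine integral_congr_ae ?_
  filter_upwards [coeFn_mulCLM h u, coeFn_mulCLM h.conjTranspose v] with x h1 h2
  rw [h1, h2]
  exact inner_toEuclideanCLM_left _ _ _

/-- The free part `i α g + m β u` of the Dirac operator, for `g = ∂ₓ u`. -/
def freeForm (m : ℝ) (u g : SpinorL2) : SpinorL2 :=
  Complex.I • constMatrix alpha g + (m : ℂ) • constMatrix beta u

/-- The value `i α g + m β u + V u` of the Dirac operator, for `g = ∂ₓ u`. -/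
def diracForm (m : ℝ) {V : ℝ → Matrix (Fin 2) (Fin 2) ℂ} {ω : ℝ → ℝ} (h : IsPotential V ω)
    (u g : SpinorL2) : SpinorL2 :=
  freeForm m u g + mulCLM h u

lemma mem_domain_dirac {m : ℝ} {V : ℝ → Matrix (Fin 2) (Fin 2) ℂ} {ω : ℝ → ℝ}
    (h : IsPotential V ω) {u : SpinorL2} :
    u ∈ (dirac m V).domain ↔ ∃ g, HasDistribDeriv u g := by
  refine ⟨fun hu => hu.1, fun hu => ⟨hu, memLp_mulFun h u⟩⟩

lemma dirac_apply {m : ℝ} {V : ℝ → Matrix (Fin 2) (Fin 2) ℂ} {ω : ℝ → ℝ}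
    (h : IsPotential V ω) {u g : SpinorL2} (hg : HasDistribDeriv u g)
    (hu : u ∈ (dirac m V).domain) : dirac m V ⟨u, hu⟩ = diracForm m h u g := by
  have h1 : derivOp ⟨u, hu.1⟩ = g := hu.1.choose_spec.unique hg
  have h2 : dirac m V ⟨u, hu⟩ = ((m : ℂ) • constMatrix beta u +
      Complex.I • constMatrix alpha (derivOp ⟨u, hu.1⟩)) + mulOp V ⟨u, hu.2⟩ := rfl
  rw [h2, h1, diracForm, freeForm, mulCLM_apply, add_comm ((m : ℂ) • _)]

lemma tendsto_diracForm {m : ℝ} {V : ℝ → Matrix (Fin 2) (Fin 2) ℂ} {ω : ℝ → ℝ}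
    (h : IsPotential V ω) {u g : SpinorL2} {un gn : ℕ → SpinorL2}
    (hu : Tendsto un atTop (𝓝 u)) (hg : Tendsto gn atTop (𝓝 g)) :
    Tendsto (fun n => diracForm m h (un n) (gn n)) atTop (𝓝 (diracForm m h u g)) := by
  unfold diracForm freeForm
  have hA := ((constMatrix alpha).continuous.tendsto g).comp hg
  have hB := ((constMatrix beta).continuous.tendsto u).comp hu
  have hV := ((mulCLM h).continuous.tendsto u).comp hu
  exact ((hA.const_smul _).add (hB.const_smul _)).add hV

lemma inner_freeForm_left {m : ℝ} {u g v : SpinorL2} :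
    inner ℂ (freeForm m u g) v =
      inner ℂ g (-Complex.I • constMatrix alpha v) + inner ℂ u ((m : ℂ) • constMatrix beta v) := by
  unfold freeForm
  rw [inner_add_left, inner_smul_left, inner_smul_left, inner_constMatrix_left,
    inner_constMatrix_left, conjTranspose_alpha, conjTranspose_beta, inner_smul_right,
    inner_smul_right, Complex.conj_I, Complex.conj_ofReal]

/-- The free Dirac operator is symmetric on `H¹`. -/
lemma inner_freeForm_self_im {m : ℝ} {u g : SpinorL2} (h : HasDistribDeriv u g) :
    (inner ℂ u (freeForm m u g)).im = 0 := by
  have h1 : inner ℂ (freeForm m u g) u = inner ℂ u (freeForm m u g) := by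
    rw [inner_freeForm_left, freeForm, inner_add_right]
    congr 1
    have h2 := h.inner_eq_neg (h.constMatrix alpha)
    rw [inner_smul_right, inner_smul_right, h2]
    ring
  have h3 := inner_conj_symm (𝕜 := ℂ) u (freeForm m u g)
  rw [h1] at h3
  exact Complex.conj_eq_iff_im.1 h3

/-- Energy identity: by symmetry of the free operator, $\operatorname{Im}\langle
u,(D_m-z)u\rangle=-\operatorname{Im}z\,\|u\|^2$. -/
lemma im_mul_norm_le_freeForm {m : ℝ} {z : ℂ} {u g : SpinorL2} (h : HasDistribDeriv u g) :
    |z.im| * ‖u‖ ≤ ‖freeForm m u g - z • u‖ := by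
  have h3 : inner ℂ u u = ((‖u‖ ^ 2 : ℝ) : ℂ) := by
    rw [inner_self_eq_norm_sq_to_K]
    push_cast
    rfl
  have h1 : (inner ℂ u (freeForm m u g - z • u)).im = -(z.im * ‖u‖ ^ 2) := by
    rw [inner_sub_right, Complex.sub_im, inner_freeForm_self_im h, inner_smul_right, h3,
      Complex.im_mul_ofReal]
    ring
  have h2 := (Complex.abs_im_le_norm _).trans
    (norm_inner_le_norm (𝕜 := ℂ) u (freeForm m u g - z • u))
  rw [h1, abs_neg, abs_mul, abs_of_nonneg (sq_nonneg ‖u‖)] at h2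
  rcases (norm_nonneg u).eq_or_lt with h0 | h0
  · rw [← h0, mul_zero]
    exact norm_nonneg _
  · nlinarith

/-! ### A priori estimates and the resolvent -/

lemma sqrt_integral_norm_sq (u : SpinorL2) : √(∫ x, ‖u x‖ ^ 2) = ‖u‖ := by
  have h : ∫ x, ‖u x‖ ^ 2 = ‖u‖ ^ 2 := by
    have h1 : inner ℂ u u = ((‖u‖ ^ 2 : ℝ) : ℂ) := by
      rw [inner_self_eq_norm_sq_to_K]
      push_cast
      rfl
    have h2 : inner ℂ u u = ((∫ x, ‖u x‖ ^ 2 : ℝ) : ℂ) := by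
      rw [L2.inner_def, ← integral_complex_ofReal]
      refine integral_congr_ae (Eventually.of_forall fun x => ?_)
      simp only
      rw [inner_self_eq_norm_sq_to_K]
      push_cast
      rfl
    exact_mod_cast h2.symm.trans h1
  rw [h, Real.sqrt_sq (norm_nonneg _)]

lemma norm_le_sqrt_integral_mul {u : SpinorL2} {θ : ℝ → ℝ} (hθ : MemLp θ 2) {S : ℝ} (hS : 0 ≤ S)
    (h : ∀ᵐ x, ‖u x‖ ≤ θ x * S) : ‖u‖ ≤ √(∫ x, θ x ^ 2) * S := by
  rw [← sqrt_integral_norm_sq u]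
  have h1 : ∫ x, ‖u x‖ ^ 2 ≤ ∫ x, θ x ^ 2 * S ^ 2 := by
    refine integral_mono_ae (Lp.memLp u).norm.integrable_sq (hθ.integrable_sq.mul_const _) ?_
    filter_upwards [h] with x hx
    rw [← mul_pow]
    exact pow_le_pow_left₀ (norm_nonneg _) hx 2
  refine (Real.sqrt_le_sqrt h1).trans (le_of_eq ?_)
  rw [integral_mul_const, Real.sqrt_mul (integral_nonneg fun x => sq_nonneg _), Real.sqrt_sq hS]

/-- The operator `H - z` on Schwartz spinors, as a linear map into `L²`. -/
def schwartzDirac (m : ℝ) {V : ℝ → Matrix (Fin 2) (Fin 2) ℂ} {ω : ℝ → ℝ} (h : IsPotential V ω)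
    (z : ℂ) : 𝓢(ℝ, Spinor) →ₗ[ℂ] SpinorL2 :=
  Complex.I • (constMatrix alpha).toLinearMap ∘ₗ derivL2Lin +
    (m : ℂ) • (constMatrix beta).toLinearMap ∘ₗ toL2Lin +
    (mulCLM h).toLinearMap ∘ₗ toL2Lin - z • toL2Lin

lemma schwartzDirac_apply (m : ℝ) {V : ℝ → Matrix (Fin 2) (Fin 2) ℂ} {ω : ℝ → ℝ}
    (h : IsPotential V ω) (z : ℂ) (φ : 𝓢(ℝ, Spinor)) :
    schwartzDirac m h z φ = diracForm m h (toL2 φ) (toL2 (∂_{(1 : ℝ)} φ)) - z • toL2 φ := rfl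

/-- The pointwise value of `(H - z) φ`. -/
def pointDirac (m : ℝ) (V : ℝ → Matrix (Fin 2) (Fin 2) ℂ) (z : ℂ) (φ : 𝓢(ℝ, Spinor)) (x : ℝ) :
    Spinor :=
  Complex.I • Matrix.toEuclideanCLM (n := Fin 2) (𝕜 := ℂ) alpha (∂_{(1 : ℝ)} φ x) +
    (m : ℂ) • Matrix.toEuclideanCLM (n := Fin 2) (𝕜 := ℂ) beta (φ x) +
    Matrix.toEuclideanCLM (n := Fin 2) (𝕜 := ℂ) (V x) (φ x) - z • φ x

lemma coeFn_schwartzDirac (m : ℝ) {V : ℝ → Matrix (Fin 2) (Fin 2) ℂ} {ω : ℝ → ℝ}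
    (h : IsPotential V ω) (z : ℂ) (φ : 𝓢(ℝ, Spinor)) :
    schwartzDirac m h z φ =ᵐ[volume] pointDirac m V z φ := by
  rw [schwartzDirac_apply, diracForm, freeForm]
  set a := constMatrix alpha (toL2 (∂_{(1 : ℝ)} φ)) with ha
  set b := constMatrix beta (toL2 φ) with hb
  set c := mulCLM h (toL2 φ) with hc
  filter_upwards [Lp.coeFn_sub (Complex.I • a + (m : ℂ) • b + c) (z • toL2 φ),
    Lp.coeFn_add (Complex.I • a + (m : ℂ) • b) c,
    Lp.coeFn_add (Complex.I • a) ((m : ℂ) • b), Lp.coeFn_smul Complex.I a,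
    Lp.coeFn_smul (m : ℂ) b, Lp.coeFn_smul z (toL2 φ), coeFn_toL2 φ,
    coeFn_toL2 (∂_{(1 : ℝ)} φ), coeFn_constMatrix alpha (toL2 (∂_{(1 : ℝ)} φ)),
    coeFn_constMatrix beta (toL2 φ), coeFn_mulCLM h (toL2 φ)]
    with x h1 h2 h3 h4 h5 h6 h7 h8 h9 h10 h11
  rw [h1, Pi.sub_apply, h2, Pi.add_apply, h3, Pi.add_apply, h4, Pi.smul_apply, h5, Pi.smul_apply,
    h6, Pi.smul_apply, h9, h10, h11, mulFun, h7, h8, pointDirac]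

lemma hasDerivAt_schwartz_apply (φ : 𝓢(ℝ, Spinor)) (i : Fin 2) (x : ℝ) :
    HasDerivAt (fun x => φ x i) (∂_{(1 : ℝ)} φ x i) x := by
  have h1 : HasDerivAt φ (∂_{(1 : ℝ)} φ x) x := by
    rw [SchwartzMap.lineDerivOp_apply_eq_fderiv, fderiv_apply_one_eq_deriv]
    exact φ.differentiableAt.hasDerivAt
  exact ((EuclideanSpace.proj (𝕜 := ℂ) i).restrictScalars ℝ).hasFDerivAt.comp_hasDerivAt x h1

lemma isClassicalSolution_schwartz (m : ℝ) {V : ℝ → Matrix (Fin 2) (Fin 2) ℂ} {ω : ℝ → ℝ}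
    (h : IsPotential V ω) (z : ℂ) (φ : 𝓢(ℝ, Spinor)) :
    IsClassicalSolution m V z (fun x => φ x 0) (fun x => φ x 1)
      (fun x => pointDirac m V z φ x 0) (fun x => pointDirac m V z φ x 1) := by
  have hc : ∀ (χ : 𝓢(ℝ, Spinor)) (i : Fin 2), Continuous fun x => χ x i := fun χ i =>
    (EuclideanSpace.proj (𝕜 := ℂ) i).continuous.comp χ.continuous
  have e0 : ∀ x, pointDirac m V z φ x 0 = -Complex.I * ∂_{(1 : ℝ)} φ x 0 + m * φ x 1 +
      (V x 0 0 * φ x 0 + V x 0 1 * φ x 1) - z * φ x 0 := fun x => by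
    simp [pointDirac, toEuclideanCLM_apply_two, alpha, beta]
  have e1 : ∀ x, pointDirac m V z φ x 1 = Complex.I * ∂_{(1 : ℝ)} φ x 1 + m * φ x 0 +
      (V x 1 0 * φ x 0 + V x 1 1 * φ x 1) - z * φ x 1 := fun x => by
    simp [pointDirac, toEuclideanCLM_apply_two, alpha, beta]
  have hφ0 := hc φ 0
  have hφ1 := hc φ 1
  have hd0 := hc (∂_{(1 : ℝ)} φ) 0
  have hd1 := hc (∂_{(1 : ℝ)} φ) 1
  have hV00 := h.continuous 0 0
  have hV01 := h.continuous 0 1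
  have hV10 := h.continuous 1 0
  have hV11 := h.continuous 1 1
  refine ⟨⟨‖φ.toBoundedContinuousFunction‖, fun x => ⟨?_, ?_⟩⟩, ?_, ?_, fun x => ?_, fun x => ?_⟩
  · exact (PiLp.norm_apply_le _ _).trans (φ.toBoundedContinuousFunction.norm_coe_le_norm x)
  · exact (PiLp.norm_apply_le _ _).trans (φ.toBoundedContinuousFunction.norm_coe_le_norm x)
  · simp only [e0]
    fun_prop
  · simp only [e1]
    fun_prop
  · refine (hasDerivAt_schwartz_apply φ 0 x).congr_deriv ?_
    rw [e0]
    linear_combination (∂_{(1 : ℝ)} φ x 0) * Complex.I_sq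
  · refine (hasDerivAt_schwartz_apply φ 1 x).congr_deriv ?_
    rw [e1]
    linear_combination (∂_{(1 : ℝ)} φ x 1) * Complex.I_sq

/-- Uniform sup bound for Schwartz spinors at large non-real spectral parameter. -/
lemma exists_norm_schwartz_le {m : ℝ} (hm : 0 < m) {V : ℝ → Matrix (Fin 2) (Fin 2) ℂ}
    {ω : ℝ → ℝ} (h : IsPotential V ω) :
    ∃ R K : ℝ, 0 < K ∧ ∀ (z : ℂ) (φ : 𝓢(ℝ, Spinor)) (f : SpinorL2), z.im ≠ 0 → R ≤ ‖z‖ →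
      Integrable (fun x => ‖f x‖) → ∀ x, ‖φ x‖ ≤
        K * ((∫ x, ‖f x‖) + ‖schwartzDirac m h z φ - f‖ / √|z.im|) := by
  obtain ⟨R, K, hK, H⟩ :=
    exists_norm_le_of_classicalSolution hm h.continuous h.integrable h.norm_le
  refine ⟨R, 2 * K, by positivity, ?_⟩
  intro z φ f hz hzR hf x
  have hae : (fun x => ‖pointDirac m V z φ x - f x‖) =ᵐ[volume]
      fun x => ‖(schwartzDirac m h z φ - f : SpinorL2) x‖ := by
    filter_upwards [Lp.coeFn_sub (schwartzDirac m h z φ) f, coeFn_schwartzDirac m h z φ]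
      with x h1 h2
    rw [h1, Pi.sub_apply, h2]
  -- The source $(H-z)\varphi$ is split as $f$, measured in $L^1$, plus the remainder, measured in
  -- $L^2$.
  have hmaj : IsMajorant (fun x => ‖f x‖) (fun x => ‖pointDirac m V z φ x - f x‖) :=
    ⟨fun _ => norm_nonneg _, fun _ => norm_nonneg _, hf,
      (memLp_congr_ae hae).2 (Lp.memLp _).norm⟩
  have hb : ∀ i x, ‖pointDirac m V z φ x i‖ ≤ ‖f x‖ + ‖pointDirac m V z φ x - f x‖ := by
    intro i x
    refine (PiLp.norm_apply_le _ _).trans ?_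
    simpa using norm_add_le (f x) (pointDirac m V z φ x - f x)
  have hsize : sourceSize |z.im| (fun x => ‖f x‖) (fun x => ‖pointDirac m V z φ x - f x‖) =
      (∫ x, ‖f x‖) + ‖schwartzDirac m h z φ - f‖ / √|z.im| := by
    unfold sourceSize
    rw [← sqrt_integral_norm_sq]
    congr 3
    refine integral_congr_ae ?_
    filter_upwards [hae] with x hx
    simp only [hx]
  have key := H z _ _ _ _ _ _ hz hzR (isClassicalSolution_schwartz m h z φ) hmaj (hb 0) (hb 1) x
  rw [hsize] at key
  have h2 : ∀ i, ‖φ x i‖ ≤ K * ((∫ x, ‖f x‖) + ‖schwartzDirac m h z φ - f‖ / √|z.im|) := by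
    intro i
    fin_cases i
    exacts [key.1, key.2]
  linarith [norm_spinor_le h2]

/-- The `L²` a priori estimate for `H - z` on `H¹`, at large non-real spectral parameter. -/
lemma exists_norm_le_diracForm {m : ℝ} (hm : 0 < m) {V : ℝ → Matrix (Fin 2) (Fin 2) ℂ}
    {ω : ℝ → ℝ} (h : IsPotential V ω) :
    ∃ R : ℝ, ∀ z : ℂ, z.im ≠ 0 → R ≤ ‖z‖ → ∃ C : ℝ, ∀ u g : SpinorL2, HasDistribDeriv u g →
      ‖u‖ ≤ C * ‖diracForm m h u g - z • u‖ := by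
  obtain ⟨R, K, hK, H⟩ := exists_norm_schwartz_le hm h
  refine ⟨R, fun z hz hzR => ?_⟩
  have hz' : 0 < |z.im| := abs_pos.2 hz
  -- `Q` bounds $\|V\varphi\|$ relative to $\|(H-z)\varphi\|$: the sup bound with the whole source
  -- in $L^2$ is multiplied by the $L^2$ norm of the potential's majorant. Treating $V\varphi$ as a
  -- perturbation in the free energy estimate then gives the constant.
  set Q := √(∫ x, (4 * ω x) ^ 2) * (K / √|z.im|) with hQ
  refine ⟨(1 + Q) / |z.im|, fun u g hug => ?_⟩
  have hS : ∀ φ : 𝓢(ℝ, Spinor), ‖toL2 φ‖ ≤ (1 + Q) / |z.im| * ‖schwartzDirac m h z φ‖ := by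
    intro φ
    have hsup : ∀ x, ‖φ x‖ ≤ K / √|z.im| * ‖schwartzDirac m h z φ‖ := by
      intro x
      have hae : (fun x => ‖(0 : SpinorL2) x‖) =ᵐ[volume] fun _ => (0 : ℝ) :=
        Eventually.of_forall fun x => by simp
      have := H z φ 0 hz hzR ((integrable_congr hae).2 (integrable_zero _ _ _)) x
      rw [integral_congr_ae hae, integral_zero, zero_add, sub_zero] at this
      exact this.trans (le_of_eq (by ring))
    have hVφ : ‖mulCLM h (toL2 φ)‖ ≤ Q * ‖schwartzDirac m h z φ‖ := by
      rw [hQ, mul_assoc]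
      refine norm_le_sqrt_integral_mul (h.memLp_two.const_mul 4) (by positivity) ?_
      filter_upwards [coeFn_mulCLM h (toL2 φ), coeFn_toL2 φ] with x h1 h2
      rw [h1]
      refine (norm_mulFun_le h _ x).trans ?_
      rw [h2]
      have := h.nonneg x
      gcongr
      exact hsup x
    have hen := im_mul_norm_le_freeForm (m := m) (z := z) (hasDistribDeriv_toL2 φ)
    have heq : freeForm m (toL2 φ) (toL2 (∂_{(1 : ℝ)} φ)) - z • toL2 φ =
        schwartzDirac m h z φ - mulCLM h (toL2 φ) := by
      rw [schwartzDirac_apply, diracForm]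
      abel
    rw [heq] at hen
    have := hen.trans (norm_sub_le _ _)
    rw [div_mul_eq_mul_div, le_div_iff₀ hz']
    linarith
  obtain ⟨φ, h1, h2⟩ := hug.exists_schwartz_tendsto
  refine le_of_tendsto_of_tendsto' h1.norm
    ((((tendsto_diracForm (m := m) h h1 h2).sub (h1.const_smul z)).norm).const_mul _) fun n => ?_
  exact hS (φ n)

/-- A vector orthogonal to the range solves the adjoint equation weakly. As $\alpha$ is invertible,
that equation exhibits its derivative in $L^2$, so it lies in $H^1$ and the injectivity hypothesis
applies. -/
lemma denseRange_schwartzDirac {m : ℝ} {V : ℝ → Matrix (Fin 2) (Fin 2) ℂ} {ω : ℝ → ℝ}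
    (h : IsPotential V ω) {z : ℂ}
    (hinj : ∀ u g : SpinorL2, HasDistribDeriv u g →
      diracForm m h.conjTranspose u g - (starRingEnd ℂ) z • u = 0 → u = 0) :
    DenseRange (schwartzDirac m h z) := by
  have hbot : (LinearMap.range (schwartzDirac m h z))ᗮ = ⊥ := by
    rw [Submodule.eq_bot_iff]
    intro w hw
    -- The value that the weak adjoint equation assigns to the derivative of $-i\alpha w$;
    -- multiplying by $i\alpha$ recovers $w'$ from it.
    set X := (m : ℂ) • constMatrix beta w + mulCLM h.conjTranspose w - (starRingEnd ℂ) z • w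
      with hX
    have hd : HasDistribDeriv (-Complex.I • constMatrix alpha w) X := by
      refine hasDistribDeriv_of_inner fun χ => ?_
      have h0 := (Submodule.mem_orthogonal _ _).1 hw _ ⟨χ, rfl⟩
      rw [schwartzDirac_apply, diracForm, inner_sub_left, inner_add_left, inner_freeForm_left,
        inner_mulCLM_left, inner_smul_left] at h0
      rw [hX, inner_sub_right, inner_add_right, inner_smul_right _ _ ((starRingEnd ℂ) z)]
      linear_combination h0
    have hd2 := (hd.constMatrix alpha).smul Complex.I
    have hI : Complex.I • constMatrix alpha (-Complex.I • constMatrix alpha w) = w := by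
      rw [map_smul, constMatrix_alpha_alpha, smul_smul]
      simp
    rw [hI] at hd2
    refine hinj w _ hd2 ?_
    unfold diracForm freeForm
    rw [map_smul, constMatrix_alpha_alpha, smul_smul, Complex.I_mul_I, hX]
    simp only [neg_smul, one_smul]
    abel
  have := (Submodule.topologicalClosure_eq_top_iff).2 hbot
  intro f
  have hf : f ∈ (LinearMap.range (schwartzDirac m h z)).topologicalClosure := by
    rw [this]
    trivial
  exact hf

/-- The lower bound makes approximate solutions converge in $L^2$. Their derivatives converge as
well, because the equation expresses $\partial_x\varphi$ through the other terms using $\alpha^2=1$.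
-/
lemma exists_diracForm_eq {m : ℝ} {V : ℝ → Matrix (Fin 2) (Fin 2) ℂ} {ω : ℝ → ℝ}
    (h : IsPotential V ω) {z : ℂ} {C : ℝ}
    (hC : ∀ u g : SpinorL2, HasDistribDeriv u g → ‖u‖ ≤ C * ‖diracForm m h u g - z • u‖)
    (hT : DenseRange (schwartzDirac m h z)) (f : SpinorL2) :
    ∃ u g : SpinorL2, HasDistribDeriv u g ∧ diracForm m h u g - z • u = f := by
  obtain ⟨φ, u, hφ, hu⟩ := exists_seq_tendsto_of_denseRange (schwartzDirac m h z) toL2Lin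
    (fun φ => hC _ _ (hasDistribDeriv_toL2 φ)) hT f
  replace hu : Tendsto (fun n => toL2 (φ n)) atTop (𝓝 u) := hu
  have hB := ((constMatrix beta).continuous.tendsto u).comp hu
  have hV := ((mulCLM h).continuous.tendsto u).comp hu
  have hlim := (((constMatrix alpha).continuous.tendsto _).comp
    (((hφ.sub (hB.const_smul (m : ℂ))).sub hV).add (hu.const_smul z))).const_smul (-Complex.I)
  have hg : Tendsto (fun n => toL2 (∂_{(1 : ℝ)} (φ n))) atTop (𝓝 (-Complex.I •
      constMatrix alpha (f - (m : ℂ) • constMatrix beta u - mulCLM h u + z • u))) := by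
    refine hlim.congr fun n => ?_
    simp only [Function.comp_apply, schwartzDirac_apply, diracForm, freeForm]
    have : Complex.I • constMatrix alpha (toL2 (∂_{(1 : ℝ)} (φ n))) +
        (m : ℂ) • constMatrix beta (toL2 (φ n)) + mulCLM h (toL2 (φ n)) - z • toL2 (φ n) -
        (m : ℂ) • constMatrix beta (toL2 (φ n)) - mulCLM h (toL2 (φ n)) + z • toL2 (φ n) =
        Complex.I • constMatrix alpha (toL2 (∂_{(1 : ℝ)} (φ n))) := by abel
    rw [this, map_smul, constMatrix_alpha_alpha, smul_smul]
    simp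
  refine ⟨u, _, HasDistribDeriv.of_tendsto (fun n => hasDistribDeriv_toL2 (φ n)) hu hg, ?_⟩
  exact tendsto_nhds_unique ((tendsto_diracForm h hu hg).sub (hu.const_smul z)) hφ

/-- A lower bound and surjectivity give the resolvent. -/
lemma exists_isResolvent {E : Type*} [NormedAddCommGroup E] [NormedSpace ℂ E]
    (A : E →ₗ.[ℂ] E) (z : ℂ) {C : ℝ} (hC : ∀ u : A.domain, ‖(u : E)‖ ≤ C * ‖A u - z • (u : E)‖)
    (hs : ∀ f, ∃ u : A.domain, A u - z • (u : E) = f) : ∃ R : E →L[ℂ] E, IsResolvent A z R := by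
  let T : A.domain →ₗ[ℂ] E := A.toFun - z • A.domain.subtype
  have hT : ∀ u, T u = A u - z • (u : E) := fun _ => rfl
  have hinj : Function.Injective T := by
    refine (injective_iff_map_eq_zero T).2 fun u hu => ?_
    have := hC u
    rw [← hT, hu, norm_zero, mul_zero] at this
    exact Subtype.ext (norm_le_zero_iff.1 this)
  let e : A.domain ≃ₗ[ℂ] E := LinearEquiv.ofBijective T ⟨hinj, hs⟩
  have he : ∀ f, A (e.symm f) - z • (e.symm f : E) = f := fun f => e.apply_symm_apply f
  let R : E →L[ℂ] E := (A.domain.subtype ∘ₗ e.symm.toLinearMap).mkContinuous C fun f => by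
    have := hC (e.symm f)
    rwa [he] at this
  refine ⟨R, fun f => (e.symm f).2, fun f => he f, fun u => ?_⟩
  exact congrArg Subtype.val (e.symm_apply_apply u)

/-- Large non-real points lie in the resolvent set. -/
lemma exists_forall_isResolvent_dirac {m : ℝ} (hm : 0 < m) {V : ℝ → Matrix (Fin 2) (Fin 2) ℂ}
    {ω : ℝ → ℝ} (h : IsPotential V ω) :
    ∃ R₀ : ℝ, ∀ z : ℂ, z.im ≠ 0 → R₀ ≤ ‖z‖ →
      ∃ R : SpinorL2 →L[ℂ] SpinorL2, IsResolvent (dirac m V) z R := by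
  obtain ⟨R₁, H₁⟩ := exists_norm_le_diracForm hm h
  obtain ⟨R₂, H₂⟩ := exists_norm_le_diracForm hm h.conjTranspose
  refine ⟨max R₁ R₂, fun z hz hzR => ?_⟩
  obtain ⟨C, hC⟩ := H₁ z hz ((le_max_left _ _).trans hzR)
  -- The adjoint problem has the same form, with $V^*$ and $\bar z$, which is again non-real and of
  -- the same modulus.
  obtain ⟨C', hC'⟩ := H₂ ((starRingEnd ℂ) z) (by simpa using hz)
    ((le_max_right _ _).trans (hzR.trans_eq (Complex.norm_conj z).symm))
  have hdense : DenseRange (schwartzDirac m h z) := denseRange_schwartzDirac h fun u g hug h0 => by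
    have := hC' u g hug
    rw [h0, norm_zero, mul_zero] at this
    exact norm_le_zero_iff.1 this
  refine exists_isResolvent _ z (C := C) (fun u => ?_) fun f => ?_
  · obtain ⟨g, hg⟩ := (mem_domain_dirac h).1 u.2
    rw [dirac_apply h hg u.2]
    exact hC u g hg
  · obtain ⟨u, g, hug, hf⟩ := exists_diracForm_eq h hC hdense f
    exact ⟨⟨u, (mem_domain_dirac h).2 ⟨g, hug⟩⟩, by rw [dirac_apply h hug]; exact hf⟩

/-! ### The weighted resolvent estimate -/

lemma bracket_rpow_eq (x r : ℝ) : bracket x ^ r = (1 + ‖x‖ ^ 2) ^ (r / 2) := by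
  rw [bracket, Real.sqrt_eq_rpow, ← Real.rpow_mul (by positivity), Real.norm_eq_abs]
  congr 1
  ring

lemma continuous_bracket_rpow (r : ℝ) : Continuous fun x => bracket x ^ r := by
  have h1 : Continuous bracket := by
    unfold bracket
    fun_prop
  exact h1.rpow_const fun x => Or.inl (by linarith [one_le_bracket x])

lemma integrable_bracket_rpow {r : ℝ} (hr : 1 < r) : Integrable fun x => bracket x ^ (-r) := by
  simp only [bracket_rpow_eq]
  exact integrable_rpow_neg_one_add_norm_sq (by simpa using hr)

lemma memLp_two_bracket_rpow {σ : ℝ} (hσ : 1 / 2 < σ) :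
    MemLp (fun x => bracket x ^ (-σ)) 2 := by
  refine (memLp_two_iff_integrable_sq (continuous_bracket_rpow _).aestronglyMeasurable).2 ?_
  refine (integrable_bracket_rpow (r := 2 * σ) (by linarith)).congr
    (Eventually.of_forall fun x => ?_)
  have h0 : 0 < bracket x := by linarith [one_le_bracket x]
  simp only
  rw [← Real.rpow_natCast, ← Real.rpow_mul h0.le]
  congr 1
  push_cast
  ring

lemma coeFn_weight (σ : ℝ) (hσ : 0 ≤ σ) (u : SpinorL2) :
    weight σ hσ u =ᵐ[volume] fun x => ((bracket x ^ (-σ) : ℝ) : ℂ) • u x := by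
  unfold weight
  filter_upwards [ContinuousLinearMap.coeFn_holder (r := 2)
    (ContinuousLinearMap.lsmul ℂ ℂ (E := Spinor)) (memLp_weight σ hσ).toLp u,
    (memLp_weight σ hσ).coeFn_toLp] with x h1 h2
  rw [ContinuousLinearMap.holderL_apply_apply, h1, h2]
  rfl

lemma norm_weight_smul (σ x : ℝ) (v : Spinor) :
    ‖((bracket x ^ (-σ) : ℝ) : ℂ) • v‖ = bracket x ^ (-σ) * ‖v‖ := by
  have h0 : 0 < bracket x := by linarith [one_le_bracket x]
  rw [norm_smul, Complex.norm_real, Real.norm_of_nonneg (by positivity)]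

/-- The weighted resolvent is bounded uniformly for large non-real spectral parameter. -/
lemma exists_norm_weighted_resolvent_le {m : ℝ} (hm : 0 < m)
    {V : ℝ → Matrix (Fin 2) (Fin 2) ℂ} {ω : ℝ → ℝ} (h : IsPotential V ω) :
    ∃ R₀ : ℝ, ∀ (σ : ℝ) (hσ : 0 ≤ σ), 1 / 2 < σ → ∃ C : ℝ, ∀ (z : ℂ)
      (R : SpinorL2 →L[ℂ] SpinorL2), z.im ≠ 0 → R₀ ≤ ‖z‖ → IsResolvent (dirac m V) z R →
      ‖weight σ hσ ∘L R ∘L weight σ hσ‖ ≤ C := by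
  obtain ⟨R₀, K, hK, H⟩ := exists_norm_schwartz_le hm h
  refine ⟨R₀, fun σ hσ hσ2 => ?_⟩
  set Q := √(∫ x, (bracket x ^ (-σ)) ^ 2) with hQ
  have hθ := memLp_two_bracket_rpow hσ2
  refine ⟨Q * (K * Q), fun z R hz hzR hR => ?_⟩
  refine ContinuousLinearMap.opNorm_le_bound _ (by positivity) fun f => ?_
  set w := weight σ hσ f with hw
  have hb0 : ∀ x, 0 ≤ bracket x ^ (-σ) := fun x => by
    have := one_le_bracket x
    positivity
  have hwae : (fun x => ‖w x‖) =ᵐ[volume] fun x => bracket x ^ (-σ) * ‖f x‖ := by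
    filter_upwards [coeFn_weight σ hσ f] with x hx
    rw [hw, hx, norm_weight_smul]
  have hwi : Integrable fun x => ‖w x‖ :=
    (integrable_congr hwae).2 (hθ.integrable_mul (Lp.memLp f).norm)
  have hwI : ∫ x, ‖w x‖ ≤ Q * ‖f‖ := by
    rw [integral_congr_ae hwae, ← sqrt_integral_norm_sq f]
    exact integral_mul_le_sqrt hb0 (fun _ => norm_nonneg _) hθ (Lp.memLp f).norm
  obtain ⟨g, hg⟩ := (mem_domain_dirac h).1 (hR.mem_domain w)
  have hRw : diracForm m h (R w) g - z • R w = w := by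
    rw [← dirac_apply h hg (hR.mem_domain w)]
    exact hR.right_inv w
  obtain ⟨φ, h1, h2⟩ := hg.exists_schwartz_tendsto
  have hT : Tendsto (fun n => schwartzDirac m h z (φ n)) atTop (𝓝 w) := by
    rw [← hRw]
    exact (tendsto_diracForm h h1 h2).sub (h1.const_smul z)
  -- For fixed $z$ the $L^2$ error tends to zero along the approximation, so the factor
  -- $1/\sqrt{|\operatorname{Im}z|}$ leaves no trace and the bound stays uniform up to the real
  -- axis.
  have hlim : Tendsto (fun n => Q * (K * ((∫ x, ‖w x‖) +
      ‖schwartzDirac m h z (φ n) - w‖ / √|z.im|))) atTop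
      (𝓝 (Q * (K * ((∫ x, ‖w x‖) + ‖w - w‖ / √|z.im|)))) :=
    ((((hT.sub_const w).norm.div_const _).const_add _).const_mul _).const_mul _
  rw [sub_self, norm_zero, zero_div, add_zero] at hlim
  have hle : ‖weight σ hσ (R w)‖ ≤ Q * (K * ∫ x, ‖w x‖) := by
    refine le_of_tendsto_of_tendsto' (((weight σ hσ).continuous.tendsto _).comp h1).norm hlim
      fun n => ?_
    refine norm_le_sqrt_integral_mul hθ ?_ ?_
    · have : 0 ≤ ∫ x, ‖w x‖ := integral_nonneg fun _ => norm_nonneg _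
      positivity
    · filter_upwards [coeFn_weight σ hσ (toL2 (φ n)), coeFn_toL2 (φ n)] with x hx hx'
      rw [Function.comp_apply, hx, norm_weight_smul, hx']
      exact mul_le_mul_of_nonneg_left (H z (φ n) w hz hzR hwi x) (hb0 x)
  calc ‖weight σ hσ (R w)‖ ≤ Q * (K * ∫ x, ‖w x‖) := hle
    _ ≤ Q * (K * (Q * ‖f‖)) := by gcongr
    _ = Q * (K * Q) * ‖f‖ := by ring

lemma isPotential_of_decay {V : ℝ → Matrix (Fin 2) (Fin 2) ℂ}
    (hV : ∀ i j, Continuous fun x => V x i j) {ε : ℝ} (hε : 0 < ε) {C : ℝ}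
    (hC : ∀ x i j, ‖V x i j‖ ≤ C * bracket x ^ (-1 - ε)) :
    IsPotential V fun x => C * bracket x ^ (-1 - ε) where
  continuous := hV
  integrable := by
    have := integrable_bracket_rpow (r := 1 + ε) (by linarith)
    rw [neg_add'] at this
    exact this.const_mul C
  norm_le := hC
  bounded := by
    refine ⟨|C|, fun x => ?_⟩
    have h1 := one_le_bracket x
    have h2 : bracket x ^ (-1 - ε) ≤ 1 := Real.rpow_le_one_of_one_le_of_nonpos h1 (by linarith)
    have h3 : 0 ≤ bracket x ^ (-1 - ε) := by positivity
    nlinarith [le_abs_self C, abs_nonneg C]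

end Dirac1D

end

/-! ### The main theorem -/

theorem corollary1p5 (m : ℝ) (hm : 0 < m) (V : ℝ → Matrix (Fin 2) (Fin 2) ℂ)
    (hVcont : ∀ i j, Continuous fun x => V x i j)
    (hVdecay : ∃ ε : ℝ, 0 < ε ∧ ∃ C : ℝ, ∀ x i j,
      ‖V x i j‖ ≤ C * Dirac1D.bracket x ^ (-1 - ε)) :
    (∀ (σ : ℝ) (hσ : 1 / 2 < σ), ∃ lam₁ : ℝ, m < lam₁ ∧ ∃ δ : ℝ, 0 < δ ∧ ∃ C : ℝ,
      ∀ lam γ : ℝ, lam₁ < |lam| → 0 < |γ| → |γ| < δ * |lam| →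
        ∃ R : Dirac1D.SpinorL2 →L[ℂ] Dirac1D.SpinorL2,
          Dirac1D.IsResolvent (Dirac1D.dirac m V) ((lam : ℂ) + (γ : ℂ) * Complex.I) R ∧
          ‖Dirac1D.weight σ (by linarith) ∘L R ∘L Dirac1D.weight σ (by linarith)‖ ≤ C) ∧
    ∃ K : Set ℂ, IsCompact K ∧
      ∀ z ∈ Dirac1D.unboundedSpectrum (Dirac1D.dirac m V), z ∉ K → z.im = 0 := by
  obtain ⟨ε, hε, C₀, hC₀⟩ := hVdecay
  have hpot := Dirac1D.isPotential_of_decay hVcont hε hC₀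
  obtain ⟨R₁, H₁⟩ := Dirac1D.exists_forall_isResolvent_dirac hm hpot
  obtain ⟨R₂, H₂⟩ := Dirac1D.exists_norm_weighted_resolvent_le hm hpot
  refine ⟨fun σ hσ => ?_, Metric.closedBall 0 R₁, isCompact_closedBall _ _, fun z hz hzK => ?_⟩
  · obtain ⟨C, hC⟩ := H₂ σ (by linarith) hσ
    -- Only $|z|\ge|\lambda|$ being large matters, so $\delta=1$ serves and any positive value
    -- would; $m+1$ is there solely to ensure $\lambda_1>m$.
    refine ⟨max (m + 1) (max R₁ R₂), lt_of_lt_of_le (by linarith) (le_max_left _ _), 1, one_pos,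
      C, fun lam γ hlam hγ _ => ?_⟩
    have him : ((lam : ℂ) + (γ : ℂ) * Complex.I).im = γ := by simp
    have hre : ((lam : ℂ) + (γ : ℂ) * Complex.I).re = lam := by simp
    have hγ0 : ((lam : ℂ) + (γ : ℂ) * Complex.I).im ≠ 0 := by
      rw [him]
      exact abs_pos.1 hγ
    have hn : max R₁ R₂ ≤ ‖(lam : ℂ) + (γ : ℂ) * Complex.I‖ := by
      have := Complex.abs_re_le_norm ((lam : ℂ) + (γ : ℂ) * Complex.I)
      rw [hre] at this
      exact (le_max_right _ _).trans (hlam.le.trans this)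
    obtain ⟨R, hR⟩ := H₁ _ hγ0 ((le_max_left _ _).trans hn)
    exact ⟨R, hR, hC _ R hγ0 ((le_max_right _ _).trans hn) hR⟩
  · by_contra him
    refine hz (H₁ z him ?_)
    simp only [Metric.mem_closedBall, dist_zero_right, not_le] at hzK
    exact hzK.le
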